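/- Let $\mathfrak g$ be a finite-dimensional real semisimple Lie algebra with Killing form $B$, and let $\mathfrak g=\mathfrak k\oplus\mathfrak p$ be a Cartan decomposition, i.e. $[\mathfrak k,\mathfrak k]\subseteq\mathfrak k$, $[\mathfrak k,\mathfrak p]\subseteq\mathfrak p$, $[\mathfrak p,\mathfrak p]\subseteq\mathfrak k$, with $B$ negative definite on $\mathfrak k$ and positive definite on $\mathfrak p$. Assume that the centre of $\mathfrak k$ is non-trivial (Hermitian type) and that every ideal of $\mathfrak g$ is contained in $\mathfrak k$ or contains $\mathfrak p$ (irreducibility: $\mathfrak g$ has only one non-compact simple ideal). Let $\mathfrak u=\mathfrak k\oplus\sqrt{-1}\,\mathfrak p\subset\mathfrak g\otimes_{\mathbb R}\mathbb C$ be the corresponding compact real form, let $U$ be a compact connected Lie group with Lie algebra (isomorphic to) $\mathfrak u$, and let $K\subseteq U$ be the closed connected Lie subgroup with Lie algebra $\mathfrak k$. Let $N_U(K)$ be the normalizer of $K$ in $U$, and let $\mu_U,\mu_K$ be the normalized Haar measures of $U$ and $K$. Let $\chi:K\to\mathbb C^{\times}$ be any continuous character, and let $a_1,\dots,a_r\in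 U\setminus N_U(K)$. Then there is exactly one complex Borel measure $\mu_{a_1,\dots,a_r,\chi}$ on $U$ such that $$\int_U f\,d\mu_{a_1,\dots,a_r,\chi}=\int_K\cdots\int_K f(k_1a_1k_2a_2\cdots k_ra_rk_{r+1})\,\chi(k_1k_2\cdots k_{r+1})^{-1}\,d\mu_K(k_1)\cdots d\mu_K(k_{r+1})$$ for every continuous $f:U\to\mathbb C$; and if $r\ge\dim U/K=\dim U-\dim K$, then $\mu_{a_1,\dots,a_r,\chi}$ is absolutely continuous with respect to $\mu_U$. -/

import Mathlib

open scoped Manifold ContDiff TensorProduct MeasureTheory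
open MeasureTheory

namespace OrbitalMeasure

section Algebra

/-- A Cartan decomposition `𝔤 = 𝔨 ⊕ 𝔭` of a real Lie algebra: `[𝔨, 𝔨] ⊆ 𝔨`, `[𝔨, 𝔭] ⊆ 𝔭`,
`[𝔭, 𝔭] ⊆ 𝔨`, and the Killing form is negative definite on `𝔨` and positive definite on `𝔭`. -/
structure CartanDecomposition (𝔤 : Type*) [LieRing 𝔤] [LieAlgebra ℝ 𝔤] where
  /-- The compact part. -/
  k : LieSubalgebra ℝ 𝔤
  /-- The noncompact part. -/
  p : Submodule ℝ 𝔤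
  isCompl : IsCompl k.toSubmodule p
  lie_k_p : ∀ x ∈ k, ∀ y ∈ p, ⁅x, y⁆ ∈ p
  lie_p_p : ∀ x ∈ p, ∀ y ∈ p, ⁅x, y⁆ ∈ k
  killing_neg : ∀ x ∈ k, x ≠ 0 → killingForm ℝ 𝔤 x x < 0
  killing_pos : ∀ x ∈ p, x ≠ 0 → 0 < killingForm ℝ 𝔤 x x

variable {𝔤 : Type*} [LieRing 𝔤] [LieAlgebra ℝ 𝔤]

namespace CartanDecomposition

variable (C : CartanDecomposition 𝔤)

/-- The copy `1 ⊗ 𝔨` of `𝔨` in the complexification `ℂ ⊗ 𝔤`. -/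
noncomputable def kC : Submodule ℝ (ℂ ⊗[ℝ] 𝔤) :=
  C.k.toSubmodule.map (TensorProduct.mk ℝ ℂ 𝔤 1)

/-- The subspace `√-1 𝔭` of the complexification `ℂ ⊗ 𝔤`. -/
noncomputable def ipC : Submodule ℝ (ℂ ⊗[ℝ] 𝔤) :=
  C.p.map (TensorProduct.mk ℝ ℂ 𝔤 Complex.I)

/-- The compact real form `𝔲 = 𝔨 ⊕ √-1 𝔭` of the complexification `ℂ ⊗ 𝔤`,
as a real Lie subalgebra. -/
noncomputable def compactForm : LieSubalgebra ℝ (ℂ ⊗[ℝ] 𝔤) where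
  __ := C.kC ⊔ C.ipC
  lie_mem' := by
    intro x y hx hy
    change x ∈ C.kC ⊔ C.ipC at hx
    change y ∈ C.kC ⊔ C.ipC at hy
    change ⁅x, y⁆ ∈ C.kC ⊔ C.ipC
    obtain ⟨_, ⟨a, ha, rfl⟩, _, ⟨b, hb, rfl⟩, rfl⟩ := Submodule.mem_sup.1 hx
    obtain ⟨_, ⟨c, hc, rfl⟩, _, ⟨d, hd, rfl⟩, rfl⟩ := Submodule.mem_sup.1 hy
    have h1 : (1 : ℂ) ⊗ₜ[ℝ] ⁅a, c⁆ ∈ C.kC := ⟨_, C.k.lie_mem ha hc, rfl⟩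
    have h2 : Complex.I ⊗ₜ[ℝ] ⁅a, d⁆ ∈ C.ipC := ⟨_, C.lie_k_p a ha d hd, rfl⟩
    have h3 : Complex.I ⊗ₜ[ℝ] ⁅b, c⁆ ∈ C.ipC := by
      refine ⟨⁅b, c⁆, ?_, rfl⟩
      rw [← lie_skew]
      exact neg_mem (C.lie_k_p c hc b hb)
    have h4 : (Complex.I * Complex.I) ⊗ₜ[ℝ] ⁅b, d⁆ ∈ C.kC := by
      rw [Complex.I_mul_I, TensorProduct.neg_tmul]
      exact neg_mem ⟨_, C.lie_p_p b hb d hd, rfl⟩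
    simp only [TensorProduct.mk_apply, lie_add, add_lie,
      LieAlgebra.ExtendScalars.bracket_tmul, one_mul, mul_one]
    exact add_mem
      (add_mem (Submodule.mem_sup_left h1) (Submodule.mem_sup_right h2))
      (add_mem (Submodule.mem_sup_right h3) (Submodule.mem_sup_left h4))

/-- The symmetric space is irreducible: there is only one noncompact simple ideal, i.e. every
ideal of `𝔤` is contained in `𝔨` or contains `𝔭`. -/
def IsIrreducible : Prop :=
  ∀ J : LieIdeal ℝ 𝔤, (∀ x ∈ J, x ∈ C.k) ∨ (∀ x ∈ C.p, x ∈ J)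

/-- Hermitian type: the centre of `𝔨` is not trivial. -/
def IsHermitian : Prop :=
  LieAlgebra.center ℝ C.k ≠ ⊥

end CartanDecomposition

end Algebra

section Pair

variable {𝔤 : Type*} [LieRing 𝔤] [LieAlgebra ℝ 𝔤]
  {m d : ℕ} {U : Type*} [Group U] [TopologicalSpace U]
  [ChartedSpace (EuclideanSpace ℝ (Fin m)) U] [LieGroup (𝓡 m) ω U]

/-- The tangent map at the identity of the inclusion of `K` in `U`, from the Lie algebra of `K`
to the Lie algebra of `U`. -/
noncomputable def inclusionDeriv (K : Subgroup U) [ChartedSpace (EuclideanSpace ℝ (Fin d)) K] :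
    GroupLieAlgebra (𝓡 d) K →L[ℝ] GroupLieAlgebra (𝓡 m) U :=
  mfderiv (𝓡 d) (𝓡 m) (Subtype.val : K → U) 1

/-- `(U, K)` is a pair attached to the Cartan decomposition `𝔤 = 𝔨 ⊕ 𝔭`: `K` is a closed connected
Lie subgroup of `U`, and some isomorphism of the Lie algebra of `U` with the compact real form
`𝔲 = 𝔨 ⊕ √-1 𝔭` carries the Lie algebra of `K` onto `𝔨`. -/
structure IsCompactPair (C : CartanDecomposition 𝔤) (K : Subgroup U)
    [ChartedSpace (EuclideanSpace ℝ (Fin d)) K] : Prop where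
  isClosed : IsClosed (K : Set U)
  isConnected : IsConnected (K : Set U)
  contMDiff_val : ContMDiff (𝓡 d) (𝓡 m) ω (Subtype.val : K → U)
  injective_deriv : Function.Injective (inclusionDeriv (m := m) (d := d) K)
  exists_lieEquiv : ∃ φ : GroupLieAlgebra (𝓡 m) U ≃ₗ⁅ℝ⁆ C.compactForm,
    ∀ X : GroupLieAlgebra (𝓡 m) U,
      X ∈ Set.range (inclusionDeriv (m := m) (d := d) K) ↔ (φ X : ℂ ⊗[ℝ] 𝔤) ∈ C.kC

end Pair

section Measure

variable {U : Type*} [Group U] {K : Subgroup U} {r : ℕ}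

/-- The product `k₁ a₁ k₂ a₂ ⋯ k_r a_r k_{r+1}`. -/
def word (a : Fin r → U) (k : Fin (r + 1) → K) : U :=
  (List.ofFn fun i : Fin r => (k i.castSucc : U) * a i).prod * (k (Fin.last r) : U)

variable [TopologicalSpace U] [MeasurableSpace U]

/-- The functional
`f ↦ ∫_K ⋯ ∫_K f (k₁ a₁ k₂ ⋯ k_r a_r k_{r+1}) χ (k₁ ⋯ k_{r+1})⁻¹ dk₁ ⋯ dk_{r+1}`. -/
noncomputable def orbitalFunctional (μK : Measure K) (χ : K →* ℂ) (a : Fin r → U)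
    (f : C(U, ℂ)) : ℂ :=
  ∫ k : Fin (r + 1) → K, f (word a k) * (χ (List.ofFn k).prod)⁻¹ ∂(Measure.pi fun _ => μK)

/-- `μ` is the complex measure `μ_{a₁, …, a_r, χ}` that represents the functional above. -/
def IsOrbitalMeasure (μK : Measure K) (χ : K →* ℂ) (a : Fin r → U)
    (μ : ComplexMeasure U) : Prop :=
  ∀ f : C(U, ℂ), μ.integral f (ContinuousLinearMap.mul ℝ ℂ) = orbitalFunctional μK χ a f

end Measure

end OrbitalMeasure

/-! Existence and uniqueness are soft. A continuous character of a compact group is unimodular, so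
the product Haar measure with density `χ⁻¹` is a complex measure; its pushforward under `word a`
represents the functional. Two complex measures with the same integrals of continuous functions
agree, because an indicator can be approximated by a continuous function in `L¹` of the sum of their
variations.

Absolute continuity holds as soon as `word a` pulls Haar-null sets back to null sets, and for this
it suffices that `word a` is a submersion at almost every `k`. Let `c_l = k₁a₁⋯k_la_l` be the
prefixes. Translated to the identity, the derivative of the word has image the sum of the spaces
`Ad(c_l) 𝔨` for `0 ≤ l ≤ r` (`adSpan`). For almost every `k`, each new letter enlarges this sum by
at least one dimension until it is all of `𝔲`, so `dim U - dim K` letters suffice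
(`ae_adSpan_eq_top`).

The growth has two sources. By `ae_not_map_le`, the set of `x ∈ K` whose adjoint action carries
`Ad(a) 𝔨` into a fixed subspace `W` is null or everything. By `exists_not_map_Ad_le` it is not
everything when `W` is proper and contains `𝔨`: otherwise `𝔨` and all `Ad(x) Ad(a) 𝔨` span a
`K`-stable proper subspace containing `𝔨`. Irreducibility of `𝔨` on `𝔭` forces that span to be `𝔨`,
so `Ad(a)` preserves `𝔨` and `a` normalizes the connected group `K`.

Haar and Lebesgue null sets are compared in charts by Fubini on the group, without computing a
density. -/

namespace OrbitalMeasure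

/-! ### Complex measures: variation, integrals, uniqueness -/

section ComplexMeasure

variable {X : Type*} [MeasurableSpace X]

theorem isFiniteMeasure_variation (μ : ComplexMeasure X) : IsFiniteMeasure μ.variation := by
  have h : μ.variation ≤ (ComplexMeasure.re μ).totalVariation +
      (ComplexMeasure.im μ).totalVariation := by
    refine VectorMeasure.variation_le_of_forall_enorm_le fun s _ => ?_
    have h1 := (ComplexMeasure.re μ).enorm_le_totalVariation s
    have h2 := (ComplexMeasure.im μ).enorm_le_totalVariation s
    calc ‖μ s‖ₑ = ‖((μ s).re : ℂ) + ((μ s).im : ℂ) * Complex.I‖ₑ := by rw [Complex.re_add_im]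
      _ ≤ ‖((μ s).re : ℂ)‖ₑ + ‖((μ s).im : ℂ) * Complex.I‖ₑ := enorm_add_le _ _
      _ = ‖(μ s).re‖ₑ + ‖(μ s).im‖ₑ := by simp [enorm_eq_nnnorm]
      _ ≤ _ := add_le_add h1 h2
  exact isFiniteMeasure_of_le _ h

/-- The integral of `f` against the complex measure with density `g`, for a unimodular `g`. -/
theorem integral_withDensityᵥ_of_norm_eq_one {P : Measure X} [IsFiniteMeasure P] {g : X → ℂ}
    (hg : AEStronglyMeasurable g P) (hg1 : ∀ x, ‖g x‖ = 1) {f : X → ℂ} (hf : Integrable f P) :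
    (P.withDensityᵥ g).integral f (ContinuousLinearMap.mul ℝ ℂ) = ∫ x, f x * g x ∂P := by
  have hgi : Integrable g P := Integrable.of_bound hg 1 (.of_forall fun x => (hg1 x).le)
  -- Unimodularity makes the variation equal to `P` itself, so both sides live on the same `L¹`
  -- space and the identity extends from indicators by density.
  have hvar : (P.withDensityᵥ g).variation = P := by
    rw [Measure.variation_withDensityᵥ hgi]
    have : (fun x => ‖g x‖ₑ) = 1 := by
      ext x; rw [← ofReal_norm, hg1]; simp
    rw [this, withDensity_one]
  have hmul : ∀ {f : X → ℂ}, Integrable f P → Integrable (fun x => f x * g x) P := fun hf =>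
    hf.mul_bdd (c := 1) hg (.of_forall fun x => (hg1 x).le)
  have hf' : Integrable f (P.withDensityᵥ g).variation := by rwa [hvar]
  refine Integrable.induction (μ := (P.withDensityᵥ g).variation)
    (fun f => (P.withDensityᵥ g).integral f (ContinuousLinearMap.mul ℝ ℂ) = ∫ x, f x * g x ∂P)
    ?_ ?_ ?_ ?_ hf'
  · intro c s hs hfin
    rw [VectorMeasure.integral, setToFun_indicator_const _ hs hfin.ne]
    have : (fun x => s.indicator (fun _ => c) x * g x) = s.indicator (fun x => c * g x) := by
      ext x; by_cases hx : x ∈ s <;> simp [hx]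
    rw [this, integral_indicator hs, integral_const_mul, ← withDensityᵥ_apply hgi hs]
    rfl
  · intro f h _ hf hh h1 h2
    rw [VectorMeasure.integral_add hf hh, h1, h2, ← integral_add]
    · simp only [Pi.add_apply, add_mul]
    · exact hmul (by rwa [hvar] at hf)
    · exact hmul (by rwa [hvar] at hh)
  · refine isClosed_eq VectorMeasure.continuous_integral ?_
    rw [hvar]
    refine (LipschitzWith.of_dist_le_mul (K := 1) fun u v => ?_).continuous
    rw [dist_eq_norm, ← integral_sub (hmul (L1.integrable_coeFn u)) (hmul (L1.integrable_coeFn v)),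
      NNReal.coe_one, one_mul, L1.dist_eq_integral_dist]
    refine (norm_integral_le_integral_norm _).trans (le_of_eq ?_)
    refine integral_congr_ae (.of_forall fun x => ?_)
    simp [← sub_mul, hg1, dist_eq_norm]
  · intro f h hfh hf h1
    rw [← VectorMeasure.integral_congr_ae hfh, h1]
    rw [hvar] at hfh
    exact integral_congr_ae (hfh.mono fun x hx => by simp [hx])

/-- A complex Borel measure on a compact metrizable space is determined by the integrals of
continuous functions. -/
theorem complexMeasure_ext_of_integral_continuous [TopologicalSpace X] [BorelSpace X]
    [CompactSpace X] [TopologicalSpace.MetrizableSpace X] {μ ν : ComplexMeasure X}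
    (h : ∀ f : C(X, ℂ), μ.integral f (ContinuousLinearMap.mul ℝ ℂ) =
      ν.integral f (ContinuousLinearMap.mul ℝ ℂ)) : μ = ν := by
  have := isFiniteMeasure_variation μ
  have := isFiniteMeasure_variation ν
  let V := μ.variation + ν.variation
  have hμV : μ.variation ≤ V := Measure.le_add_right le_rfl
  have hνV : ν.variation ≤ V := Measure.le_add_left le_rfl
  -- Since `V` dominates both variations, one continuous approximation of the indicator in `L¹(V)`
  -- serves for `μ` and `ν` at once.
  have key : ∀ (ρ : ComplexMeasure X), ρ.variation ≤ V → IsFiniteMeasure ρ.variation →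
      ∀ s, MeasurableSet s → ∀ f : BoundedContinuousFunction X ℂ,
      ‖ρ s - ρ.integral f (ContinuousLinearMap.mul ℝ ℂ)‖ₑ ≤
        ∫⁻ x, ‖s.indicator (fun _ => (1 : ℂ)) x - f x‖ₑ ∂V := by
    intro ρ hρ _ s hs f
    have h1 : ρ s = ρ.integral (s.indicator fun _ => (1 : ℂ)) (ContinuousLinearMap.mul ℝ ℂ) := by
      rw [VectorMeasure.integral, setToFun_indicator_const _ hs (measure_ne_top _ _)]
      exact (one_mul (ρ s)).symm
    have hi : Integrable (s.indicator fun _ => (1 : ℂ)) ρ.variation :=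
      (integrable_const _).indicator hs
    rw [h1, ← VectorMeasure.integral_sub hi (f.integrable _)]
    refine VectorMeasure.enorm_integral_le_lintegral_enorm.trans ?_
    have hB : ‖ContinuousLinearMap.mul ℝ ℂ‖ₑ ≤ 1 := by
      rw [← ofReal_norm]
      simp
    calc _ ≤ 1 * ∫⁻ x, ‖(s.indicator (fun _ => (1 : ℂ)) - ⇑f) x‖ₑ ∂ρ.variation := by gcongr
      _ ≤ _ := by rw [one_mul]; exact lintegral_mono' hρ le_rfl
  ext s hs
  rw [← sub_eq_zero, ← enorm_eq_zero]
  refine le_antisymm (le_of_forall_pos_le_add fun ε hε => ?_) (zero_le)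
  obtain ⟨f, hf, -⟩ := ((integrable_const (1 : ℂ)).indicator hs :
    Integrable (s.indicator fun _ => (1 : ℂ)) V).exists_boundedContinuous_lintegral_sub_le
    (ε := ε / 2) (ENNReal.half_pos hε.ne').ne'
  have e : μ s - ν s = (μ s - μ.integral f (ContinuousLinearMap.mul ℝ ℂ)) -
      (ν s - ν.integral f (ContinuousLinearMap.mul ℝ ℂ)) := by
    have := h f.toContinuousMap
    change μ.integral f _ = ν.integral f _ at this
    rw [this]; ring
  rw [e, zero_add]
  refine (enorm_sub_le).trans ?_
  refine (add_le_add ((key μ hμV inferInstance s hs f).trans hf)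
    ((key ν hνV inferInstance s hs f).trans hf)).trans (ENNReal.add_halves ε).le

/-- The powers of `χ g` stay in a bounded set, so `‖χ g‖ ≤ 1`; the same bound for `g⁻¹` gives
equality. -/
theorem norm_eq_one_of_continuous_character {G : Type*} [Group G] [TopologicalSpace G]
    [CompactSpace G] (χ : G →* ℂ) (hχ : Continuous χ) (g : G) : ‖χ g‖ = 1 := by
  have hle : ∀ g, ‖χ g‖ ≤ 1 := by
    intro g
    by_contra! hg
    obtain ⟨C, hC⟩ := (isCompact_range (hχ.norm)).bddAbove
    obtain ⟨n, hn⟩ := pow_unbounded_of_one_lt C hg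
    have := hC ⟨g ^ n, rfl⟩
    simp only [map_pow, norm_pow] at this
    exact absurd this (not_le.2 hn)
  refine le_antisymm (hle g) ?_
  have h1 : ‖χ g‖ * ‖χ g⁻¹‖ = 1 := by
    rw [← norm_mul, ← map_mul, mul_inv_cancel, map_one, norm_one]
  nlinarith [hle g⁻¹, norm_nonneg (χ g)]

end ComplexMeasure

instance secondCountableTopology_subgroup {U : Type*} [Group U] [TopologicalSpace U]
    [SecondCountableTopology U] (K : Subgroup U) : SecondCountableTopology K :=
  inferInstanceAs (SecondCountableTopology (K : Set U))

/-! ### Existence of the orbital measure -/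

section Existence

variable {U : Type*} [Group U] [TopologicalSpace U] [IsTopologicalGroup U] [CompactSpace U]
  [MeasurableSpace U] [BorelSpace U]
  {K : Subgroup U} {r : ℕ}

omit [CompactSpace U] [MeasurableSpace U] [BorelSpace U] in
theorem continuous_word (a : Fin r → U) : Continuous (word a : (Fin (r + 1) → K) → U) := by
  unfold word
  refine Continuous.mul ?_ (by fun_prop)
  have : ∀ l : List (Fin r), Continuous fun k : Fin (r + 1) → K =>
      (l.map fun i => (k i.castSucc : U) * a i).prod := fun l =>
    continuous_list_prod l fun i _ => by fun_prop
  simpa [List.ofFn_eq_map] using this (List.finRange r)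

/-- The complex measure attached to `a₁, …, a_r` and `χ`. -/
noncomputable def orbitalMeasure (μK : Measure K) (χ : K →* ℂ) (a : Fin r → U) :
    ComplexMeasure U :=
  ((Measure.pi fun _ : Fin (r + 1) => μK).withDensityᵥ
    fun k => (χ (List.ofFn k).prod)⁻¹).map (word a)

variable [SecondCountableTopology U] (μK : Measure K) [IsProbabilityMeasure μK]
  {χ : K →* ℂ} (hχ : Continuous χ) (hK : IsClosed (K : Set U))

include hχ hK

omit [MeasurableSpace U] [BorelSpace U] [SecondCountableTopology U] in
theorem continuous_character_prod :
    Continuous fun k : Fin (r + 1) → K => (χ (List.ofFn k).prod)⁻¹ := by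
  have : CompactSpace K := isCompact_iff_compactSpace.1 hK.isCompact
  refine Continuous.inv₀ (hχ.comp ?_) fun k => ?_
  · have : ∀ l : List (Fin (r + 1)), Continuous fun k : Fin (r + 1) → K => (l.map k).prod :=
      fun l => continuous_list_prod l fun i _ => by fun_prop
    simp_rw [List.ofFn_eq_map]
    exact this _
  · rw [← norm_ne_zero_iff, norm_eq_one_of_continuous_character χ hχ]
    exact one_ne_zero

omit [IsTopologicalGroup U] [MeasurableSpace U] [BorelSpace U]
  [SecondCountableTopology U] in
theorem norm_character_prod (k : Fin (r + 1) → K) : ‖(χ (List.ofFn k).prod)⁻¹‖ = 1 := by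
  have : CompactSpace K := isCompact_iff_compactSpace.1 hK.isCompact
  rw [norm_inv, norm_eq_one_of_continuous_character χ hχ, inv_one]

theorem integrable_character_prod :
    Integrable (fun k : Fin (r + 1) → K => (χ (List.ofFn k).prod)⁻¹)
      (Measure.pi fun _ => μK) :=
  Integrable.of_bound (continuous_character_prod hχ hK).aestronglyMeasurable 1
    (.of_forall fun k => (norm_character_prod hχ hK k).le)

theorem isOrbitalMeasure_orbitalMeasure (a : Fin r → U) :
    IsOrbitalMeasure μK χ a (orbitalMeasure μK χ a) := by
  have : CompactSpace K := isCompact_iff_compactSpace.1 hK.isCompact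
  intro f
  have hc := continuous_word (K := K) a
  have hfi : Integrable (fun k : Fin (r + 1) → K => f (word a k)) (Measure.pi fun _ => μK) := by
    obtain ⟨C, hC⟩ := (isCompact_range f.continuous.norm).bddAbove
    exact Integrable.of_bound (f.continuous.comp hc).aestronglyMeasurable C
      (.of_forall fun k => hC ⟨_, rfl⟩)
  rw [orbitalMeasure, VectorMeasure.integral_map hc.measurable
    f.continuous.aestronglyMeasurable, orbitalFunctional]
  · exact integral_withDensityᵥ_of_norm_eq_one
      (continuous_character_prod hχ hK).aestronglyMeasurable (norm_character_prod hχ hK) hfi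
  · rw [VectorMeasure.Integrable, Measure.variation_withDensityᵥ
      (integrable_character_prod μK hχ hK)]
    have : (fun k : Fin (r + 1) → K => ‖(χ (List.ofFn k).prod)⁻¹‖ₑ) = 1 := by
      ext k; rw [← ofReal_norm, norm_character_prod hχ hK]; simp
    rw [this, withDensity_one]
    exact hfi

/-- The character enters only as a density, which cannot charge a null set. What remains is the
hypothesis `h` on `word a`, which no longer involves `χ`. -/
theorem orbitalMeasure_absolutelyContinuous (μU : Measure U) (a : Fin r → U)
    (h : ∀ s, MeasurableSet s → μU s = 0 → (Measure.pi fun _ => μK) (word a ⁻¹' s) = 0) :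
    orbitalMeasure μK χ a ≪ᵥ μU.toENNRealVectorMeasure := by
  refine VectorMeasure.AbsolutelyContinuous.mk fun s hs h0 => ?_
  rw [Measure.toENNRealVectorMeasure_apply_measurable hs] at h0
  have hm := (continuous_word (K := K) a).measurable
  rw [orbitalMeasure, VectorMeasure.map_apply _ hm hs,
    withDensityᵥ_apply (integrable_character_prod μK hχ hK) (hm hs),
    setIntegral_measure_zero _ (h s hs h0)]

end Existence

end OrbitalMeasure

namespace OrbitalMeasure

/-! ### Irreducibility of the isotropy representation -/

namespace CartanDecomposition

variable {𝔤 : Type*} [LieRing 𝔤] [LieAlgebra ℝ 𝔤]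

/-- For an irreducible symmetric pair `𝔨` acts irreducibly on `𝔭`. -/
theorem eq_bot_or_eq_p_of_lie_mem [FiniteDimensional ℝ 𝔤] (C : CartanDecomposition 𝔤)
    (hirr : C.IsIrreducible) {V : Submodule ℝ 𝔤} (hV : V ≤ C.p)
    (hinv : ∀ x ∈ C.k, ∀ v ∈ V, ⁅x, v⁆ ∈ V) : V = ⊥ ∨ V = C.p := by
  set B := killingForm ℝ 𝔤 with hB
  have hsymm : ∀ x y, B x y = B y x := fun x y => LieModule.traceForm_comm ℝ 𝔤 𝔤 x y
  have hlie : ∀ x y z, B ⁅x, y⁆ z = B x ⁅y, z⁆ := fun x y z =>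
    LieModule.traceForm_apply_lie_apply ℝ 𝔤 𝔤 x y z
  have hrefl : B.IsRefl := fun x y h => by rw [hsymm, h]
  have hcompl : IsCompl V (LinearMap.BilinForm.orthogonal B V) := by
    refine LinearMap.BilinForm.isCompl_orthogonal_of_restrict_nondegenerate hrefl ?_
    have hs : (LinearMap.BilinForm.restrict B V).IsRefl := fun x y h => hrefl _ _ h
    refine hs.nondegenerate_iff_separatingLeft.2 fun x hx => ?_
    by_contra hne
    exact (C.killing_pos x (hV x.2) fun h => hne (Subtype.ext h)).ne' (hx x)
  -- The bracket `[w, v]` lies in `𝔨`, hence preserves `V`. Invariance gives `B([w,v],[w,v]) =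
  -- -B(w,[[w,v],v]) = 0`, and `B` is definite on `𝔨`.
  have horth : ∀ v ∈ V, ∀ w ∈ C.p, w ∈ LinearMap.BilinForm.orthogonal B V → ⁅w, v⁆ = 0 := by
    intro v hv w hw hwo
    by_contra hne
    have hk := C.lie_p_p w hw v (hV hv)
    have h2 : B ⁅w, v⁆ ⁅w, v⁆ = 0 := by
      rw [hlie, ← lie_skew v, map_neg, neg_eq_zero, hsymm]
      exact LinearMap.BilinForm.mem_orthogonal_iff.1 hwo _ (hinv _ hk v hv)
    exact (C.killing_neg _ hk hne).ne h2
  set W : Submodule ℝ 𝔤 := Submodule.span ℝ {x | ∃ v ∈ V, ∃ w ∈ V, ⁅v, w⁆ = x} with hW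
  have hWmem : ∀ v ∈ V, ∀ w ∈ V, ⁅v, w⁆ ∈ W := fun v hv w hw =>
    Submodule.subset_span ⟨v, hv, w, hw, rfl⟩
  have hdec : ∀ x : 𝔤, ∃ k ∈ C.k, ∃ v ∈ V, ∃ w ∈ C.p,
      w ∈ LinearMap.BilinForm.orthogonal B V ∧ x = k + v + w := by
    intro x
    obtain ⟨k, hk, p, hp, rfl⟩ := Submodule.mem_sup.1 (C.isCompl.sup_eq_top ▸ Submodule.mem_top :
      x ∈ C.k.toSubmodule ⊔ C.p)
    obtain ⟨v, hv, w, hw, rfl⟩ := Submodule.mem_sup.1 (hcompl.sup_eq_top ▸ Submodule.mem_top :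
      p ∈ V ⊔ LinearMap.BilinForm.orthogonal B V)
    refine ⟨k, hk, v, hv, w, ?_, hw, by abel⟩
    simpa using sub_mem hp (hV hv)
  -- `V + [V, V]` is an ideal: `𝔨` preserves both summands, `[[V, V], V] ⊆ V` because `[V, V] ⊆ 𝔨`,
  -- and the complement of `V` in `𝔭` annihilates everything here by `horth`.
  have hJ : ∀ x : 𝔤, ∀ y ∈ V ⊔ W, ⁅x, y⁆ ∈ V ⊔ W := by
    intro x y hy
    obtain ⟨k, hk, v, hv, w, hw, hwo, rfl⟩ := hdec x
    obtain ⟨a, ha, b, hb, rfl⟩ := Submodule.mem_sup.1 hy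
    rw [lie_add]
    refine add_mem ?_ ?_
    · rw [add_lie, add_lie, horth a ha w hw hwo, add_zero]
      exact add_mem (Submodule.mem_sup_left (hinv k hk a ha))
        (Submodule.mem_sup_right (hWmem v hv a ha))
    · clear hy
      induction hb using Submodule.span_induction with
      | mem b hb =>
        obtain ⟨c, hc, d, hd, rfl⟩ := hb
        rw [add_lie, add_lie, leibniz_lie w, horth c hc w hw hwo, horth d hd w hw hwo, zero_lie,
          lie_zero, add_zero, add_zero, leibniz_lie k, ← lie_skew v]
        refine add_mem (Submodule.mem_sup_right (add_mem (hWmem _ (hinv k hk c hc) _ hd)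
          (hWmem _ hc _ (hinv k hk d hd)))) (Submodule.mem_sup_left (neg_mem ?_))
        exact hinv _ (C.lie_p_p c (hV hc) d (hV hd)) v hv
      | zero => simp
      | add b c _ _ h1 h2 => rw [lie_add]; exact add_mem h1 h2
      | smul t b _ h1 => rw [lie_smul]; exact Submodule.smul_mem _ t h1
  let J : LieIdeal ℝ 𝔤 := { V ⊔ W with lie_mem := fun {x y} hy => hJ x y hy }
  have hWk : W ≤ C.k.toSubmodule := by
    refine Submodule.span_le.2 ?_
    rintro _ ⟨v, hv, w, hw, rfl⟩
    exact C.lie_p_p v (hV hv) w (hV hw)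
  rcases hirr J with h | h
  · left
    refine (Submodule.eq_bot_iff _).2 fun v hv => ?_
    have hvk : v ∈ C.k.toSubmodule := h v (Submodule.mem_sup_left hv : v ∈ V ⊔ W)
    exact (Submodule.disjoint_def.1 C.isCompl.disjoint) v hvk (hV hv)
  · right
    refine le_antisymm hV fun p hp => ?_
    obtain ⟨v, hv, w, hw, hvw⟩ := Submodule.mem_sup.1 (h p hp : p ∈ V ⊔ W)
    have : w = 0 := by
      refine (Submodule.disjoint_def.1 C.isCompl.disjoint) w (hWk hw) ?_
      rw [← add_sub_cancel_left v w, hvw]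
      exact sub_mem hp (hV hv)
    rw [← hvw, this, add_zero]
    exact hv

/-- A subspace of the compact form that contains `𝔨` and is stable under `𝔨` is `𝔨` or
everything. -/
theorem subset_kC_or_eq_top [FiniteDimensional ℝ 𝔤] (C : CartanDecomposition 𝔤)
    (hirr : C.IsIrreducible) (S : Submodule ℝ C.compactForm)
    (hk : ∀ x : C.compactForm, (x : ℂ ⊗[ℝ] 𝔤) ∈ C.kC → x ∈ S)
    (hinv : ∀ x : C.compactForm, (x : ℂ ⊗[ℝ] 𝔤) ∈ C.kC → ∀ y ∈ S, ⁅x, y⁆ ∈ S) :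
    (∀ y ∈ S, (y : ℂ ⊗[ℝ] 𝔤) ∈ C.kC) ∨ S = ⊤ := by
  set S' : Submodule ℝ (ℂ ⊗[ℝ] 𝔤) := S.map C.compactForm.toSubmodule.subtype with hS'
  have hmem : ∀ y : C.compactForm, (y : ℂ ⊗[ℝ] 𝔤) ∈ S' ↔ y ∈ S := fun y =>
    ⟨fun ⟨z, hz, hzy⟩ => (Subtype.ext hzy : z = y) ▸ hz, fun hy => ⟨y, hy, rfl⟩⟩
  -- As `S` contains `𝔨`, it is determined by its part in `√-1 𝔭`; `V` is that part brought back to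
  -- `𝔭`.
  let V : Submodule ℝ 𝔤 := C.p ⊓ S'.comap (TensorProduct.mk ℝ ℂ 𝔤 Complex.I)
  have hsub1 : ∀ x ∈ C.k, (1 : ℂ) ⊗ₜ[ℝ] x ∈ C.kC := fun x hx => ⟨x, hx, rfl⟩
  have hkcf : ∀ x, x ∈ C.kC → x ∈ C.compactForm := fun x hx =>
    (Submodule.mem_sup_left hx : x ∈ C.kC ⊔ C.ipC)
  have hpcf : ∀ y ∈ C.p, Complex.I ⊗ₜ[ℝ] y ∈ C.compactForm := fun y hy =>
    (Submodule.mem_sup_right ⟨y, hy, rfl⟩ : Complex.I ⊗ₜ[ℝ] y ∈ C.kC ⊔ C.ipC)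
  have hV : ∀ x ∈ C.k, ∀ v ∈ V, ⁅x, v⁆ ∈ V := by
    rintro x hx v ⟨hvp, hv⟩
    refine ⟨C.lie_k_p x hx v hvp, ?_⟩
    have := hinv ⟨_, hkcf _ (hsub1 x hx)⟩ (hsub1 x hx) ⟨_, hpcf v hvp⟩ ((hmem _).1 hv)
    rw [← hmem] at this
    simpa using this
  have hdec : ∀ y : C.compactForm, ∃ k ∈ C.kC, ∃ p ∈ C.p,
      (y : ℂ ⊗[ℝ] 𝔤) = k + Complex.I ⊗ₜ[ℝ] p := by
    intro y
    obtain ⟨k, hk, _, ⟨p, hp, rfl⟩, h⟩ := Submodule.mem_sup.1 (y.2 : (y : ℂ ⊗[ℝ] 𝔤) ∈ C.kC ⊔ C.ipC)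
    exact ⟨k, hk, p, hp, h.symm⟩
  have hkS : ∀ k ∈ C.kC, k ∈ S' := fun k h => (hmem ⟨k, hkcf k h⟩).2 (hk _ h)
  rcases C.eq_bot_or_eq_p_of_lie_mem hirr (V := V) inf_le_left hV with h | h
  · left
    intro y hy
    obtain ⟨k, hk, p, hp, hy'⟩ := hdec y
    have hpV : p ∈ V := by
      refine ⟨hp, ?_⟩
      have := sub_mem ((hmem y).2 hy) (hkS k hk)
      rw [hy', add_sub_cancel_left] at this
      exact this
    replace hpV : p = 0 := (Submodule.mem_bot ℝ).1 (h ▸ hpV)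
    rw [hy', hpV, TensorProduct.tmul_zero, add_zero]
    exact hk
  · right
    refine eq_top_iff.2 fun y _ => ?_
    obtain ⟨k, hk, p, hp, hy'⟩ := hdec y
    rw [← hmem, hy']
    exact add_mem (hkS k hk) ((h.ge hp : p ∈ V).2)

end CartanDecomposition

end OrbitalMeasure

namespace OrbitalMeasure

/-! ### A null-or-everything law for representations of compact connected groups -/

section Representation

open Filter Topology

variable {G : Type*} [Group G] [TopologicalSpace G] [IsTopologicalGroup G]

theorem subgroup_eq_top_of_mem_nhds_one [PreconnectedSpace G] (H : Subgroup G)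
    (h : (H : Set G) ∈ 𝓝 (1 : G)) : H = ⊤ := by
  have ho := H.isOpen_of_mem_nhds h
  refine SetLike.coe_injective ?_
  rw [Subgroup.coe_top]
  exact IsClopen.eq_univ ⟨H.isClosed_of_isOpen ho, ho⟩ ⟨1, H.one_mem⟩

variable [MeasurableSpace G] [BorelSpace G] [CompactSpace G] [T2Space G]
  [SecondCountableTopology G]

/-- Translation is continuous in measure: `μ(gZ ∆ Z)` tends to `0` as `g → 1`, whereas it would be
at least `μ Z` if `gZ ∩ Z` were null. -/
theorem eventually_measure_preimage_inter_ne_zero (μ : Measure G) [IsFiniteMeasure μ]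
    [μ.IsMulLeftInvariant] {Z : Set G} (hZ : MeasurableSet Z) (h0 : μ Z ≠ 0) :
    ∀ᶠ g in 𝓝 (1 : G), μ ((fun x => g⁻¹ * x) ⁻¹' Z ∩ Z) ≠ 0 := by
  let F : C(G, C(G, G)) := ContinuousMap.curry ⟨fun p : G × G => p.1⁻¹ * p.2, by fun_prop⟩
  have hF : ∀ g, MeasurePreserving (F g) μ μ := fun g => measurePreserving_mul_left μ g⁻¹
  have ht := tendsto_measure_symmDiff_preimage_nhds_zero (μ := μ) (ν := μ) (s := Z)
    (F.continuous.tendsto 1) (.of_forall hF) (hF 1) hZ.nullMeasurableSet (measure_ne_top _ _)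
  have hF1 : F 1 ⁻¹' Z = Z := by ext x; simp [F]
  rw [hF1] at ht
  filter_upwards [ht.eventually_lt_const (pos_iff_ne_zero.2 h0)] with g hg hc
  have h1 : μ (Z \ (F g ⁻¹' Z)) = μ Z := measure_sdiff_null' (by
    rw [Set.inter_comm]; exact hc)
  refine absurd hg (not_lt.2 ?_)
  rw [← h1]
  exact measure_mono Set.subset_union_right

variable {E : Type*} [NormedAddCommGroup E] [NormedSpace ℝ E] [FiniteDimensional ℝ E]

/-- Under a finite-dimensional representation of a compact connected group, the set of elements
that carry a subspace `P` into a subspace `W` is either everything or null. -/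
theorem ae_not_map_le [ConnectedSpace G] (μ : Measure G) [IsFiniteMeasure μ]
    [μ.IsMulLeftInvariant] {ρ : G →* (E →L[ℝ] E)} (hρ : Continuous ρ) (P W : Submodule ℝ E)
    (h : ∃ x, ¬ P.map (ρ x : E →ₗ[ℝ] E) ≤ W) :
    ∀ᵐ x ∂μ, ¬ P.map (ρ x : E →ₗ[ℝ] E) ≤ W := by
  set Z : Submodule ℝ E → Set G := fun W => {x | P.map (ρ x : E →ₗ[ℝ] E) ≤ W} with hZ
  have hmem : ∀ W x, x ∈ Z W ↔ ∀ v ∈ P, ρ x v ∈ W := fun W x => Submodule.map_le_iff_le_comap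
  by_contra hne
  have hne' : μ (Z W) ≠ 0 := by
    intro h0
    exact hne (by simpa [ae_iff, hZ] using h0)
  have hclosed : ∀ W, IsClosed (Z W) := by
    intro W
    have : Z W = ⋂ v ∈ P, (fun x => ρ x v) ⁻¹' (W : Set E) := by
      ext x; simp [hmem]
    rw [this]
    exact isClosed_biInter fun v _ => (Submodule.closed_of_finiteDimensional W).preimage
      (hρ.clm_apply continuous_const)
  -- Take `W₀ ≤ W` minimal with `Z W₀` of positive measure. For `g` near `1`, the set `g Z(W₀) ∩
  -- Z(W₀)` still has positive measure and lies in `Z(W₀ ⊓ ρ(g)W₀)`, so minimality gives `ρ(g)W₀ =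
  -- W₀`. The stabilizer of `W₀` is then open, hence all of `G`, and one `y ∈ Z W₀` puts every `x`
  -- in `Z W₀`.
  obtain ⟨W₀, ⟨hle, h0⟩, hmin⟩ := wellFounded_lt.has_min
    {W' : Submodule ℝ E | W' ≤ W ∧ μ (Z W') ≠ 0} ⟨W, le_rfl, hne'⟩
  have hinv : ∀ g v, ρ g⁻¹ (ρ g v) = v := fun g v => by
    rw [← mul_apply_eq_comp, ← map_mul]; simp
  have hinv' : ∀ g v, ρ g (ρ g⁻¹ v) = v := fun g v => by
    rw [← mul_apply_eq_comp, ← map_mul]; simp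
  let T : Subgroup G :=
    { carrier := {g | W₀.map (ρ g : E →ₗ[ℝ] E) = W₀}
      one_mem' := by
        change W₀.map _ = W₀
        rw [map_one]; exact Submodule.map_id W₀
      mul_mem' := by
        intro a b ha hb
        change W₀.map _ = W₀
        rw [map_mul]
        exact (Submodule.map_comp _ _ W₀).trans ((congrArg _ hb).trans ha)
      inv_mem' := by
        intro a ha
        change W₀.map _ = W₀
        conv_lhs => rw [← (show W₀.map _ = W₀ from ha)]
        rw [← Submodule.map_comp]
        convert Submodule.map_id W₀
        ext v
        exact hinv a v }
  have hT : T = ⊤ := by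
    refine subgroup_eq_top_of_mem_nhds_one T ?_
    filter_upwards [eventually_measure_preimage_inter_ne_zero μ (hclosed W₀).measurableSet h0]
      with g hg
    have hsub : (fun x => g⁻¹ * x) ⁻¹' Z W₀ ∩ Z W₀ ⊆ Z (W₀ ⊓ W₀.map (ρ g : E →ₗ[ℝ] E)) := by
      rintro x ⟨hx1, hx2⟩
      rw [hmem]
      intro v hv
      refine ⟨(hmem _ _).1 hx2 v hv, ρ (g⁻¹ * x) v, (hmem _ _).1 hx1 v hv, ?_⟩
      rw [map_mul]
      exact hinv' g _
    have h1 := hmin _ ⟨inf_le_left.trans hle, fun h => hg (measure_mono_null hsub h)⟩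
    have h2 : W₀ ≤ W₀.map (ρ g : E →ₗ[ℝ] E) :=
      inf_eq_left.1 (eq_of_le_of_not_lt inf_le_left h1)
    exact (Submodule.eq_of_le_of_finrank_le h2 (Submodule.finrank_map_le _ _)).symm
  obtain ⟨x, hx⟩ := h
  obtain ⟨y, hy⟩ := nonempty_of_measure_ne_zero h0
  refine hx fun w hw => ?_
  obtain ⟨v, hv, rfl⟩ := hw
  have hxy : x * y⁻¹ ∈ T := hT ▸ Subgroup.mem_top _
  have h3 : ρ (x * y⁻¹) (ρ y v) ∈ W₀.map (ρ (x * y⁻¹) : E →ₗ[ℝ] E) :=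
    ⟨_, (hmem _ _).1 hy v hv, rfl⟩
  rw [show W₀.map _ = W₀ from hxy, ← mul_apply_eq_comp, ← map_mul,
    inv_mul_cancel_right] at h3
  exact hle h3

end Representation

end OrbitalMeasure

namespace OrbitalMeasure

/-! ### The adjoint representation and its derivative -/

section Adjoint

open Filter Topology

variable (E : Type*) [NormedAddCommGroup E] [NormedSpace ℝ E]
  {G : Type*} [TopologicalSpace G] [ChartedSpace E G] [Group G] [LieGroup 𝓘(ℝ, E) ω G]

theorem contMDiff_conj (g : G) : ContMDiff 𝓘(ℝ, E) 𝓘(ℝ, E) ω fun x : G => g * x * g⁻¹ :=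
  (contMDiff_const.mul contMDiff_id).mul contMDiff_const

/-- The adjoint representation as a map to the endomorphisms of the model space. -/
noncomputable def Ad (g : G) : E →L[ℝ] E :=
  (mfderiv 𝓘(ℝ, E) 𝓘(ℝ, E) (fun x : G => g * x * g⁻¹) (1 : G) :)

theorem hasMFDerivAt_conj (g : G) :
    HasMFDerivAt 𝓘(ℝ, E) 𝓘(ℝ, E) (fun x : G => g * x * g⁻¹) (1 : G) (Ad E g) :=
  ((contMDiff_conj E g).mdifferentiableAt (by simp)).hasMFDerivAt

variable {E}

/-- The chain rule with the base point as a separate equation: identities such as `g * 1 * g⁻¹ = 1`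
are not definitional, and rewriting them inside tangent spaces is awkward. -/
theorem _root_.HasMFDerivAt.comp_of_point_eq {E E' E'' : Type*}
    [NormedAddCommGroup E] [NormedSpace ℝ E]
    [NormedAddCommGroup E'] [NormedSpace ℝ E'] [NormedAddCommGroup E''] [NormedSpace ℝ E'']
    {M M' M'' : Type*} [TopologicalSpace M] [ChartedSpace E M] [TopologicalSpace M']
    [ChartedSpace E' M'] [TopologicalSpace M''] [ChartedSpace E'' M'']
    {f : M → M'} {g : M' → M''} {x : M} {y : M'} {f' : E →L[ℝ] E'} {g' : E' →L[ℝ] E''}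
    (hg : HasMFDerivAt 𝓘(ℝ, E') 𝓘(ℝ, E'') g y g') (hf : HasMFDerivAt 𝓘(ℝ, E) 𝓘(ℝ, E') f x f')
    (h : f x = y) : HasMFDerivAt 𝓘(ℝ, E) 𝓘(ℝ, E'') (fun z => g (f z)) x (g' ∘L f') := by
  subst h
  exact hg.comp x hf

variable (E) in
theorem Ad_mul (g h : G) : Ad E (g * h) = Ad E g ∘L Ad E h := by
  have h1 := (hasMFDerivAt_conj E g).comp_of_point_eq (hasMFDerivAt_conj E h) (by simp)
  have h2 := hasMFDerivAt_conj E (g * h)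
  have : (fun x : G => g * h * x * (g * h)⁻¹) = fun x => g * (h * x * h⁻¹) * g⁻¹ := by
    ext x; group
  rw [this] at h2
  exact hasMFDerivAt_unique h2 h1

variable (E) in
theorem Ad_one : Ad E (1 : G) = ContinuousLinearMap.id ℝ E := by
  have h2 := hasMFDerivAt_conj E (1 : G)
  have : (fun x : G => 1 * x * 1⁻¹) = id := by ext x; simp
  rw [this] at h2
  exact hasMFDerivAt_unique h2 (hasMFDerivAt_id _)

variable (E) in
/-- The adjoint representation as a monoid homomorphism. -/
noncomputable def adHom : G →* (E →L[ℝ] E) where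
  toFun := Ad E
  map_one' := Ad_one E
  map_mul' := Ad_mul E

-- The derivative in `x` of a map smooth jointly in `(g, x)` is smooth in `g`. Both base points are
-- always `1`, so the coordinate changes of the tangent bundle are trivial and the coordinate
-- expression is `Ad` itself.
variable (E) in
theorem contMDiff_Ad : ContMDiff 𝓘(ℝ, E) 𝓘(ℝ, E →L[ℝ] E) 1 (Ad E : G → (E →L[ℝ] E)) := by
  intro g₀
  have : IsManifold 𝓘(ℝ, E) 1 G := IsManifold.of_le (n := ω) (by simp)
  have hf : ContMDiffAt (𝓘(ℝ, E).prod 𝓘(ℝ, E)) 𝓘(ℝ, E) ω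
      (Function.uncurry fun g x : G => g * x * g⁻¹) (g₀, 1) :=
    ((contMDiff_fst.mul contMDiff_snd).mul contMDiff_fst.inv).contMDiffAt
  have h := ContMDiffAt.mfderiv (m := 1) (fun g x : G => g * x * g⁻¹) (fun _ => (1 : G)) hf
    contMDiffAt_const (by simp)
  refine h.congr_of_eventuallyEq (.of_forall fun g => ?_)
  have hone : ∀ x : G, x * 1 * x⁻¹ = 1 := fun x => by simp
  refine Eq.trans ?_ (inTangentCoordinates_eq (I := 𝓘(ℝ, E)) (I' := 𝓘(ℝ, E)) (fun _ : G => (1 : G))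
    (fun x : G => x * 1 * x⁻¹) (Ad E) (x₀ := g₀) (x := g) (by simp) (by simp)).symm
  ext v
  simp only [hone, ContinuousLinearMap.comp_apply]
  rw [(tangentBundleCore 𝓘(ℝ, E) G).coordChange_self _ _ (mem_achart_source E (1 : G)),
    (tangentBundleCore 𝓘(ℝ, E) G).coordChange_self _ _ (mem_achart_source E (1 : G))]

variable (E) in
theorem hasMFDerivAt_extChartAt_one :
    HasMFDerivAt 𝓘(ℝ, E) 𝓘(ℝ, E) (extChartAt 𝓘(ℝ, E) (1 : G)) (1 : G)
      (ContinuousLinearMap.id ℝ E) := by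
  have : IsManifold 𝓘(ℝ, E) 1 G := IsManifold.of_le (n := ω) (by simp)
  have h := (mdifferentiableAt_extChartAt (I := 𝓘(ℝ, E)) (mem_chart_source E (1 : G))).hasMFDerivAt
  rwa [mfderiv_extChartAt_self] at h

variable (E) in
theorem hasMFDerivAt_extChartAt_symm_one :
    HasMFDerivAt 𝓘(ℝ, E) 𝓘(ℝ, E) (extChartAt 𝓘(ℝ, E) (1 : G)).symm
      (extChartAt 𝓘(ℝ, E) (1 : G) 1) (ContinuousLinearMap.id ℝ E) := by
  have : IsManifold 𝓘(ℝ, E) 1 G := IsManifold.of_le (n := ω) (by simp)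
  have h := (mdifferentiableWithinAt_extChartAt_symm (I := 𝓘(ℝ, E))
    (mem_extChartAt_target (I := 𝓘(ℝ, E)) (1 : G))).hasMFDerivWithinAt
  rw [mfderivWithin_range_extChartAt_symm, ModelWithCorners.range_eq_univ] at h
  exact hasMFDerivWithinAt_univ.1 h

variable (E) in
/-- The multiplication of the group in the chart at the identity. -/
noncomputable def chartMul (G : Type*) [TopologicalSpace G] [ChartedSpace E G] [Group G]
    (p : E × E) : E :=
  extChartAt 𝓘(ℝ, E) (1 : G) ((extChartAt 𝓘(ℝ, E) (1 : G)).symm p.1 *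
    (extChartAt 𝓘(ℝ, E) (1 : G)).symm p.2)

variable (E) in
theorem contDiffAt_chartMul :
    ContDiffAt ℝ ω (chartMul E G) (extChartAt 𝓘(ℝ, E) (1 : G) 1, extChartAt 𝓘(ℝ, E) (1 : G) 1) := by
  have : IsManifold 𝓘(ℝ, E) ω G := inferInstance
  rw [← contMDiffAt_iff_contDiffAt]
  have hs : ContMDiffAt 𝓘(ℝ, E) 𝓘(ℝ, E) ω (extChartAt 𝓘(ℝ, E) (1 : G)).symm
      (extChartAt 𝓘(ℝ, E) (1 : G) 1) :=
    (contMDiffOn_extChartAt_symm (1 : G)).contMDiffAt (extChartAt_target_mem_nhds (1 : G))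
  have h1 : ContMDiffAt 𝓘(ℝ, E × E) 𝓘(ℝ, E) ω (fun p : E × E =>
      (extChartAt 𝓘(ℝ, E) (1 : G)).symm p.1)
      (extChartAt 𝓘(ℝ, E) (1 : G) 1, extChartAt 𝓘(ℝ, E) (1 : G) 1) :=
    ContMDiffAt.comp (I' := 𝓘(ℝ, E)) _ hs contDiff_fst.contMDiff.contMDiffAt
  have h2 : ContMDiffAt 𝓘(ℝ, E × E) 𝓘(ℝ, E) ω (fun p : E × E =>
      (extChartAt 𝓘(ℝ, E) (1 : G)).symm p.2)
      (extChartAt 𝓘(ℝ, E) (1 : G) 1, extChartAt 𝓘(ℝ, E) (1 : G) 1) :=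
    ContMDiffAt.comp (I' := 𝓘(ℝ, E)) _ hs contDiff_snd.contMDiff.contMDiffAt
  refine ContMDiffAt.comp_of_eq (I' := 𝓘(ℝ, E))
    (contMDiffAt_extChartAt (x := (1 : G))) (h1.mul h2) ?_
  simp

omit [Group G] [LieGroup 𝓘(ℝ, E) ω G] in
theorem eventually_extChartAt_symm_extChartAt (x₀ : G) :
    ∀ᶠ y in 𝓝 x₀, (extChartAt 𝓘(ℝ, E) x₀).symm (extChartAt 𝓘(ℝ, E) x₀ y) = y :=
  Filter.mem_of_superset (extChartAt_source_mem_nhds (I := 𝓘(ℝ, E)) x₀)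
    fun _ hy => (extChartAt 𝓘(ℝ, E) x₀).left_inv hy

theorem hasMFDerivAt_extChartAt_mul_left {x : E} (hx : DifferentiableAt ℝ (chartMul E G)
    (x, extChartAt 𝓘(ℝ, E) (1 : G) 1)) :
    HasMFDerivAt 𝓘(ℝ, E) 𝓘(ℝ, E) (fun y : G => extChartAt 𝓘(ℝ, E) (1 : G)
      ((extChartAt 𝓘(ℝ, E) (1 : G)).symm x * y)) (1 : G)
      (fderiv ℝ (chartMul E G) (x, extChartAt 𝓘(ℝ, E) (1 : G) 1) ∘L
        ContinuousLinearMap.inr ℝ E E) := by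
  have h1 : HasFDerivAt (fun y : E => chartMul E G (x, y)) _ _ :=
    hx.hasFDerivAt.comp (extChartAt 𝓘(ℝ, E) (1 : G) 1) (hasFDerivAt_prodMk_right x _)
  have h2 := h1.hasMFDerivAt.comp (1 : G) (hasMFDerivAt_extChartAt_one E)
  refine HasMFDerivAt.congr_of_eventuallyEq h2 ?_
  filter_upwards [eventually_extChartAt_symm_extChartAt (E := E) (1 : G)] with y hy
  simp only [Function.comp_apply, chartMul]
  rw [hy]

theorem hasMFDerivAt_extChartAt_mul_right {x : E} (hx : DifferentiableAt ℝ (chartMul E G)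
    (extChartAt 𝓘(ℝ, E) (1 : G) 1, x)) :
    HasMFDerivAt 𝓘(ℝ, E) 𝓘(ℝ, E) (fun y : G => extChartAt 𝓘(ℝ, E) (1 : G)
      (y * (extChartAt 𝓘(ℝ, E) (1 : G)).symm x)) (1 : G)
      (fderiv ℝ (chartMul E G) (extChartAt 𝓘(ℝ, E) (1 : G) 1, x) ∘L
        ContinuousLinearMap.inl ℝ E E) := by
  have h1 : HasFDerivAt (fun y : E => chartMul E G (y, x)) _ _ :=
    HasFDerivAt.comp (g := chartMul E G) (extChartAt 𝓘(ℝ, E) (1 : G) 1) hx.hasFDerivAt (hasFDerivAt_prodMk_left _ x)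
  have h2 := h1.hasMFDerivAt.comp (1 : G) (hasMFDerivAt_extChartAt_one E)
  refine HasMFDerivAt.congr_of_eventuallyEq h2 ?_
  filter_upwards [eventually_extChartAt_symm_extChartAt (E := E) (1 : G)] with y hy
  simp only [Function.comp_apply, chartMul]
  rw [hy]

/-- In the chart a left-invariant field is a partial derivative of the multiplication; this turns
the bracket, defined through vector fields, into a second derivative of `chartMul`. -/
theorem mpullbackWithin_mulInvariantVectorField {x : E}
    (hxt : x ∈ (extChartAt 𝓘(ℝ, E) (1 : G)).target)
    (hx : DifferentiableAt ℝ (chartMul E G) (x, extChartAt 𝓘(ℝ, E) (1 : G) 1))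
    (w : GroupLieAlgebra 𝓘(ℝ, E) G) :
    VectorField.mpullbackWithin 𝓘(ℝ, E) 𝓘(ℝ, E) (extChartAt 𝓘(ℝ, E) (1 : G)).symm
      (mulInvariantVectorField w) (Set.range 𝓘(ℝ, E)) x =
    fderiv ℝ (chartMul E G) (x, extChartAt 𝓘(ℝ, E) (1 : G) 1) ((0 : E), w) := by
  have : IsManifold 𝓘(ℝ, E) 1 G := IsManifold.of_le (n := ω) (by simp)
  have hinv := ContinuousLinearMap.inverse_eq
    (mfderivWithin_extChartAt_symm_comp_mfderiv_extChartAt hxt)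
    (mfderiv_extChartAt_comp_mfderivWithin_extChartAt_symm hxt)
  rw [VectorField.mpullbackWithin_apply, hinv]
  have h1 : HasMFDerivAt 𝓘(ℝ, E) 𝓘(ℝ, E)
      (fun y : G => (extChartAt 𝓘(ℝ, E) (1 : G)).symm x * y) (1 : G)
      (mfderiv 𝓘(ℝ, E) 𝓘(ℝ, E) (fun y : G => (extChartAt 𝓘(ℝ, E) (1 : G)).symm x * y) (1 : G)) :=
    ((contMDiff_mul_left (I := 𝓘(ℝ, E)) (n := ω)).mdifferentiableAt (by simp)).hasMFDerivAt
  have h2 : HasMFDerivAt 𝓘(ℝ, E) 𝓘(ℝ, E) (extChartAt 𝓘(ℝ, E) (1 : G))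
      ((extChartAt 𝓘(ℝ, E) (1 : G)).symm x) _ :=
    (mdifferentiableAt_extChartAt (I := 𝓘(ℝ, E)) (by
      simpa using (extChartAt 𝓘(ℝ, E) (1 : G)).map_target hxt)).hasMFDerivAt
  have h3 := h2.comp_of_point_eq h1 (mul_one _)
  have h4 := hasMFDerivAt_unique h3 (hasMFDerivAt_extChartAt_mul_left hx)
  have h5 := congrArg (fun L : E →L[ℝ] E => L w) h4
  exact h5

theorem fderiv_chartMul_inr (w : E) : fderiv ℝ (chartMul E G)
    (extChartAt 𝓘(ℝ, E) (1 : G) 1, extChartAt 𝓘(ℝ, E) (1 : G) 1) (0, w) = w := by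
  have h := hasMFDerivAt_extChartAt_mul_left
    ((contDiffAt_chartMul E (G := G)).differentiableAt (by simp))
  have h' := hasMFDerivAt_unique (h.congr_of_eventuallyEq (.of_forall fun y => by simp))
    (hasMFDerivAt_extChartAt_one E)
  exact congrArg (fun L : E →L[ℝ] E => L w) h'

theorem fderiv_chartMul_inl (w : E) : fderiv ℝ (chartMul E G)
    (extChartAt 𝓘(ℝ, E) (1 : G) 1, extChartAt 𝓘(ℝ, E) (1 : G) 1) (w, 0) = w := by
  have h := hasMFDerivAt_extChartAt_mul_right
    ((contDiffAt_chartMul E (G := G)).differentiableAt (by simp))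
  have h' := hasMFDerivAt_unique (h.congr_of_eventuallyEq (.of_forall fun y => by simp))
    (hasMFDerivAt_extChartAt_one E)
  exact congrArg (fun L : E →L[ℝ] E => L w) h'

variable (E G) in
/-- The second derivative of the multiplication in the chart at the identity. -/
noncomputable def chartMulSnd (p q : E × E) : E :=
  fderiv ℝ (fderiv ℝ (chartMul E G))
    (extChartAt 𝓘(ℝ, E) (1 : G) 1, extChartAt 𝓘(ℝ, E) (1 : G) 1) p q

theorem chartMulSnd_comm (p q : E × E) : chartMulSnd E G p q = chartMulSnd E G q p :=
  ((contDiffAt_chartMul E (G := G)).isSymmSndFDerivAt (by simp)).eq p q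

theorem hasFDerivAt_fderiv_chartMul :
    HasFDerivAt (fderiv ℝ (chartMul E G)) (fderiv ℝ (fderiv ℝ (chartMul E G))
      (extChartAt 𝓘(ℝ, E) (1 : G) 1, extChartAt 𝓘(ℝ, E) (1 : G) 1))
      (extChartAt 𝓘(ℝ, E) (1 : G) 1, extChartAt 𝓘(ℝ, E) (1 : G) 1) :=
  (((contDiffAt_chartMul E (G := G)).fderiv_right (m := 1) (by simp)).differentiableAt
    (by simp)).hasFDerivAt

theorem eventually_differentiableAt_chartMul : ∀ᶠ p in
    𝓝 (extChartAt 𝓘(ℝ, E) (1 : G) 1, extChartAt 𝓘(ℝ, E) (1 : G) 1),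
    DifferentiableAt ℝ (chartMul E G) p :=
  (((contDiffAt_chartMul E (G := G)).of_le (m := 1) (by simp)).eventually (by simp)).mono
    fun _ h => h.differentiableAt (by simp)

variable (E G) in
/-- The bracket of the Lie algebra of `G`, as an operation on the model space. -/
noncomputable def groupBracket (v w : E) : E :=
  @Bracket.bracket (GroupLieAlgebra 𝓘(ℝ, E) G) (GroupLieAlgebra 𝓘(ℝ, E) G) _ v w

/-- The Lie bracket of a Lie group in terms of the multiplication in a chart. -/
theorem groupBracket_eq_chartMulSnd [CompleteSpace E] (v w : E) :
    groupBracket E G v w =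
      chartMulSnd E G (v, 0) (0, w) - chartMulSnd E G (w, 0) (0, v) := by
  have : IsManifold 𝓘(ℝ, E) 1 G := IsManifold.of_le (n := ω) (by simp)
  set e := extChartAt 𝓘(ℝ, E) (1 : G) 1 with he
  have hfield : ∀ w : E,
      VectorField.mpullbackWithin 𝓘(ℝ, E) 𝓘(ℝ, E) (extChartAt 𝓘(ℝ, E) (1 : G)).symm
        (mulInvariantVectorField (G := G) (I := 𝓘(ℝ, E)) w) (Set.range 𝓘(ℝ, E)) =ᶠ[𝓝 e]
      fun x => fderiv ℝ (chartMul E G) (x, e) ((0 : E), w) := by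
    intro w
    have hc : Tendsto (fun x : E => (x, e)) (𝓝 e) (𝓝 (e, e)) :=
      Continuous.tendsto (by fun_prop) e
    filter_upwards [hc.eventually eventually_differentiableAt_chartMul,
      extChartAt_target_mem_nhds (I := 𝓘(ℝ, E)) (1 : G)] with x hx hxt
    exact mpullbackWithin_mulInvariantVectorField hxt hx w
  have hder : ∀ w : E, HasFDerivAt (fun x => fderiv ℝ (chartMul E G) (x, e) ((0 : E), w))
      (((ContinuousLinearMap.apply ℝ E ((0 : E), w)) ∘L
        fderiv ℝ (fderiv ℝ (chartMul E G)) (e, e)) ∘L ContinuousLinearMap.inl ℝ E E) e := by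
    intro w
    exact HasFDerivAt.comp (g := fun p => fderiv ℝ (chartMul E G) p ((0 : E), w)) e
      ((ContinuousLinearMap.apply ℝ E ((0 : E), w)).hasFDerivAt.comp (e, e)
      hasFDerivAt_fderiv_chartMul) (hasFDerivAt_prodMk_left e e)
  have hs : (extChartAt 𝓘(ℝ, E) (1 : G)).symm ⁻¹' Set.univ ∩ Set.range 𝓘(ℝ, E) = Set.univ := by
    simp
  have key : ∀ V W : E → E, V =ᶠ[𝓝 e] (fun x => fderiv ℝ (chartMul E G) (x, e) ((0 : E), v)) →
      W =ᶠ[𝓝 e] (fun x => fderiv ℝ (chartMul E G) (x, e) ((0 : E), w)) →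
      VectorField.lieBracketWithin ℝ V W
        ((extChartAt 𝓘(ℝ, E) (1 : G)).symm ⁻¹' Set.univ ∩ Set.range 𝓘(ℝ, E)) e =
      chartMulSnd E G (v, 0) (0, w) - chartMulSnd E G (w, 0) (0, v) := by
    intro V W hV hW
    rw [hs, VectorField.lieBracketWithin_univ, VectorField.lieBracket_eq]
    change fderiv ℝ W e (V e) - fderiv ℝ V e (W e) = _
    rw [hV.fderiv_eq, hW.fderiv_eq, (hder v).fderiv, (hder w).fderiv, hV.eq_of_nhds,
      hW.eq_of_nhds, he, fderiv_chartMul_inr, fderiv_chartMul_inr]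
    rfl
  refine Eq.trans ?_ (key _ _ (hfield v) (hfield w))
  refine (GroupLieAlgebra.bracket_def (I := 𝓘(ℝ, E)) (G := G) v w).trans
    ((congrFun VectorField.mlieBracketWithin_univ.symm 1).trans
      (VectorField.mlieBracketWithin_apply.trans ?_))
  rw [mfderiv_extChartAt_self]
  change (ContinuousLinearMap.id ℝ E).inverse _ = _
  rw [ContinuousLinearMap.inverse_id]
  rfl

/-- The derivative of the adjoint representation at the identity is the Lie bracket. -/
theorem exists_hasMFDerivAt_Ad [CompleteSpace E] : ∃ D : E →L[ℝ] E →L[ℝ] E,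
    HasMFDerivAt 𝓘(ℝ, E) 𝓘(ℝ, E →L[ℝ] E) (Ad E : G → (E →L[ℝ] E)) (1 : G) D ∧
    ∀ v w, D v w = groupBracket E G v w := by
  set e := extChartAt 𝓘(ℝ, E) (1 : G) 1 with he
  let D : E →L[ℝ] E →L[ℝ] E :=
    (mfderiv 𝓘(ℝ, E) 𝓘(ℝ, E →L[ℝ] E) (Ad E : G → (E →L[ℝ] E)) (1 : G) :)
  have hD : HasMFDerivAt 𝓘(ℝ, E) 𝓘(ℝ, E →L[ℝ] E) (Ad E : G → (E →L[ℝ] E)) (1 : G) D :=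
    ((contMDiff_Ad E (G := G)).mdifferentiableAt (by simp)).hasMFDerivAt
  refine ⟨D, hD, fun v w => ?_⟩
  let A : E → E →L[ℝ] E := fun x => Ad E ((extChartAt 𝓘(ℝ, E) (1 : G)).symm x)
  have hA : HasFDerivAt A D e := by
    have := hD.comp_of_point_eq (hasMFDerivAt_extChartAt_symm_one E (G := G)) (by simp)
    exact hasMFDerivAt_iff_hasFDerivAt.1 this
  have hAe : A e = ContinuousLinearMap.id ℝ E := by simp [A, he, Ad_one]
  have hF := hasFDerivAt_fderiv_chartMul (E := E) (G := G)
  have hL : HasFDerivAt (fun x => fderiv ℝ (chartMul E G) (x, e) ((0 : E), w))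
      (((ContinuousLinearMap.apply ℝ E ((0 : E), w)) ∘L
        fderiv ℝ (fderiv ℝ (chartMul E G)) (e, e)) ∘L ContinuousLinearMap.inl ℝ E E) e :=
    HasFDerivAt.comp (g := fun p => fderiv ℝ (chartMul E G) p ((0 : E), w)) e
      ((ContinuousLinearMap.apply ℝ E ((0 : E), w)).hasFDerivAt.comp (e, e) hF)
      (hasFDerivAt_prodMk_left e e)
  have hR1 : HasFDerivAt (fun x => fderiv ℝ (chartMul E G) (e, x))
      (fderiv ℝ (fderiv ℝ (chartMul E G)) (e, e) ∘L ContinuousLinearMap.inr ℝ E E) e :=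
    HasFDerivAt.comp e hF (hasFDerivAt_prodMk_right e e)
  have hR2 : HasFDerivAt (fun x => ContinuousLinearMap.inl ℝ E E (A x w))
      (ContinuousLinearMap.inl ℝ E E ∘L (ContinuousLinearMap.apply ℝ E w ∘L D)) e :=
    (ContinuousLinearMap.inl ℝ E E).hasFDerivAt.comp e
      ((ContinuousLinearMap.apply ℝ E w).hasFDerivAt.comp e hA)
  have hR := hR1.clm_apply hR2
  -- This is `x y = (x y x⁻¹) x` differentiated in `y` at the identity. Differentiating it again, in
  -- `x` along `v`, yields `hu'`; symmetry of the second derivative then produces the bracket.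
  have heq : (fun x => fderiv ℝ (chartMul E G) (x, e) ((0 : E), w)) =ᶠ[𝓝 e]
      fun x => fderiv ℝ (chartMul E G) (e, x) (ContinuousLinearMap.inl ℝ E E (A x w)) := by
    have hc1 : Tendsto (fun x : E => (x, e)) (𝓝 e) (𝓝 (e, e)) :=
      Continuous.tendsto (by fun_prop) e
    have hc2 : Tendsto (fun x : E => (e, x)) (𝓝 e) (𝓝 (e, e)) :=
      Continuous.tendsto (by fun_prop) e
    filter_upwards [hc1.eventually eventually_differentiableAt_chartMul,
      hc2.eventually eventually_differentiableAt_chartMul] with x h1 h2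
    have hl := hasMFDerivAt_extChartAt_mul_left h1
    have hr := (hasMFDerivAt_extChartAt_mul_right h2).comp_of_point_eq
      (hasMFDerivAt_conj E ((extChartAt 𝓘(ℝ, E) (1 : G)).symm x)) (by simp)
    have := hasMFDerivAt_unique hl (hr.congr_of_eventuallyEq (.of_forall fun y => by simp))
    exact congrArg (fun L : E →L[ℝ] E => L w) this
  have hu := congrArg (fun L : E →L[ℝ] E => L v) (hL.unique (hR.congr_of_eventuallyEq heq))
  have hu' : chartMulSnd E G (v, 0) (0, w) =
      D v w + chartMulSnd E G (0, v) (w, 0) := by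
    have h1 : fderiv ℝ (chartMul E G) (e, e) (D v w, 0) = D v w := fderiv_chartMul_inl _
    rw [← h1]
    have h2 : A e w = w := by rw [hAe]; rfl
    simp only [add_apply, ContinuousLinearMap.comp_apply,
      ContinuousLinearMap.flip_apply, h2] at hu
    exact hu
  rw [groupBracket_eq_chartMulSnd, eq_sub_iff_add_eq, chartMulSnd_comm (w, 0), ← hu']

/-- A subspace stable under the adjoint action of the image of a Lie group homomorphism is stable
under the bracket with the image of its derivative. -/
theorem lie_mem_of_forall_Ad_mem [FiniteDimensional ℝ E] {E' : Type*} [NormedAddCommGroup E']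
    [NormedSpace ℝ E'] {M : Type*} [TopologicalSpace M] [ChartedSpace E' M] {f : M → G} {x₀ : M}
    (hx₀ : f x₀ = 1) {f' : E' →L[ℝ] E} (hf : HasMFDerivAt 𝓘(ℝ, E') 𝓘(ℝ, E) f x₀ f')
    {S : Submodule ℝ E} (hS : ∀ x, ∀ s ∈ S, Ad E (f x) s ∈ S) (X : E')
    {s : E} (hs : s ∈ S) : groupBracket E G (f' X) s ∈ S := by
  obtain ⟨D, hD, hbr⟩ := exists_hasMFDerivAt_Ad (E := E) (G := G)
  rw [← hbr]
  by_contra hne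
  -- A functional vanishing on `S` but not on the bracket is impossible: `x ↦ l (Ad (f x) s)` is
  -- identically zero, and its derivative along `X` is the value of `l` at the bracket.
  obtain ⟨l, hl, hlS⟩ := Submodule.exists_le_ker_of_notMem hne
  let l' : E →L[ℝ] ℝ := LinearMap.toContinuousLinearMap l
  have h1 : HasMFDerivAt 𝓘(ℝ, E →L[ℝ] E) 𝓘(ℝ, ℝ) (fun L : E →L[ℝ] E => l' (L s)) (Ad E (1 : G))
      (l' ∘L ContinuousLinearMap.apply ℝ E s) :=
    (l' ∘L ContinuousLinearMap.apply ℝ E s).hasFDerivAt.hasMFDerivAt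
  have h2 := h1.comp_of_point_eq (hD.comp_of_point_eq hf hx₀) (by rw [hx₀])
  have h3 : (fun x => l' (Ad E (f x) s)) = fun _ => 0 := by
    ext x
    exact hlS (hS x s hs)
  rw [h3] at h2
  have h4 := hasMFDerivAt_unique h2 (hasMFDerivAt_const 0 x₀)
  exact hl (congrArg (fun L : E' →L[ℝ] ℝ => L X) h4)

end Adjoint

end OrbitalMeasure

namespace OrbitalMeasure

/-! ### From the Lie algebra of a subgroup to its normalizer -/

section Normalizer

open Filter Topology

variable {E : Type*} [NormedAddCommGroup E] [NormedSpace ℝ E]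
  {G : Type*} [TopologicalSpace G] [ChartedSpace E G] [Group G] [LieGroup 𝓘(ℝ, E) ω G]

variable (E G) in
theorem contMDiffAt_extChartAt_symm_one :
    ContMDiffAt 𝓘(ℝ, E) 𝓘(ℝ, E) ω (extChartAt 𝓘(ℝ, E) (1 : G)).symm
      (extChartAt 𝓘(ℝ, E) (1 : G) 1) :=
  (contMDiffOn_extChartAt_symm (1 : G)).contMDiffAt (extChartAt_target_mem_nhds (1 : G))

variable {F : Type*} [NormedAddCommGroup F] [NormedSpace ℝ F]
  {H : Type*} [TopologicalSpace H] [ChartedSpace F H] [Group H] [LieGroup 𝓘(ℝ, F) ω H]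
  {j : H →* G} {T : F →L[ℝ] E}

theorem Ad_comp_deriv (hT : HasMFDerivAt 𝓘(ℝ, F) 𝓘(ℝ, E) j (1 : H) T) (x : H) :
    Ad E (j x) ∘L T = T ∘L Ad F x := by
  have h1 := (hasMFDerivAt_conj E (j x)).comp_of_point_eq hT (map_one j)
  have h2 := hT.comp_of_point_eq (hasMFDerivAt_conj F x) (by simp)
  have : (fun z => j x * j z * (j x)⁻¹) = fun z => j (x * z * x⁻¹) := by ext z; simp
  rw [this] at h1
  exact hasMFDerivAt_unique h1 h2

theorem map_Ad_range (hT : HasMFDerivAt 𝓘(ℝ, F) 𝓘(ℝ, E) j (1 : H) T) (x : H) :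
    (T : F →ₗ[ℝ] E).range.map (Ad E (j x) : E →ₗ[ℝ] E) ≤ (T : F →ₗ[ℝ] E).range := by
  rintro _ ⟨_, ⟨X, rfl⟩, rfl⟩
  exact ⟨Ad F x X, (congrArg (fun L : F →L[ℝ] E => L X) (Ad_comp_deriv hT x)).symm⟩

/-- A product chart `(y, s) ↦ σ(s) j(y)` transverse to a subgroup. -/
noncomputable def slice (j : H →* G) (P : Submodule ℝ E) (p : F × P) : E :=
  extChartAt 𝓘(ℝ, E) (1 : G)
    ((extChartAt 𝓘(ℝ, E) (1 : G)).symm (extChartAt 𝓘(ℝ, E) (1 : G) 1 + p.2) *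
      j ((extChartAt 𝓘(ℝ, F) (1 : H)).symm p.1))

omit [LieGroup 𝓘(ℝ, E) ω G] [LieGroup 𝓘(ℝ, F) ω H] in
theorem slice_one (P : Submodule ℝ E) :
    slice j P (extChartAt 𝓘(ℝ, F) (1 : H) 1, 0) = extChartAt 𝓘(ℝ, E) (1 : G) 1 := by
  simp [slice]

theorem contDiffAt_slice (hj : ContMDiff 𝓘(ℝ, F) 𝓘(ℝ, E) ω j) (P : Submodule ℝ E) :
    ContDiffAt ℝ ω (slice j P) (extChartAt 𝓘(ℝ, F) (1 : H) 1, 0) := by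
  rw [← contMDiffAt_iff_contDiffAt]
  have h1 : ContMDiffAt 𝓘(ℝ, F × P) 𝓘(ℝ, E) ω (fun p : F × P =>
      (extChartAt 𝓘(ℝ, E) (1 : G)).symm (extChartAt 𝓘(ℝ, E) (1 : G) 1 + p.2))
      (extChartAt 𝓘(ℝ, F) (1 : H) 1, 0) := by
    refine ContMDiffAt.comp_of_eq (I' := 𝓘(ℝ, E)) (contMDiffAt_extChartAt_symm_one E G)
      (f := fun p : F × P => extChartAt 𝓘(ℝ, E) (1 : G) 1 + p.2)
      (ContDiff.contMDiff ?_).contMDiffAt (by simp)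
    exact contDiff_const.add (P.subtypeL.contDiff.comp contDiff_snd)
  have h2 : ContMDiffAt 𝓘(ℝ, F × P) 𝓘(ℝ, E) ω (fun p : F × P =>
      j ((extChartAt 𝓘(ℝ, F) (1 : H)).symm p.1)) (extChartAt 𝓘(ℝ, F) (1 : H) 1, 0) :=
    hj.contMDiffAt.comp _ (ContMDiffAt.comp (I' := 𝓘(ℝ, F)) _
      (contMDiffAt_extChartAt_symm_one F H) contDiff_fst.contMDiff.contMDiffAt)
  refine ContMDiffAt.comp_of_eq (I' := 𝓘(ℝ, E))
    (contMDiffAt_extChartAt (x := (1 : G))) (h1.mul h2) ?_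
  simp

/-- With `s = 0` the slice is `j` in charts, with derivative `T`; with `y` at the identity it is the
translation `s ↦ e + s`. When `P` complements the range of an injective `T`, the inverse function
theorem applies. -/
theorem fderiv_slice (hj : ContMDiff 𝓘(ℝ, F) 𝓘(ℝ, E) ω j)
    (hT : HasMFDerivAt 𝓘(ℝ, F) 𝓘(ℝ, E) j (1 : H) T) (P : Submodule ℝ E) :
    fderiv ℝ (slice j P) (extChartAt 𝓘(ℝ, F) (1 : H) 1, 0) = T.coprod P.subtypeL := by
  have hd := ((contDiffAt_slice hj P).differentiableAt (by simp)).hasFDerivAt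
  refine ContinuousLinearMap.prod_ext ?_ ?_
  · have h1 : HasFDerivAt (fun y => slice j P (y, 0)) _ (extChartAt 𝓘(ℝ, F) (1 : H) 1) :=
      HasFDerivAt.comp (g := slice j P) (extChartAt 𝓘(ℝ, F) (1 : H) 1) hd
        (hasFDerivAt_prodMk_left _ _)
    have h2 := (hasMFDerivAt_extChartAt_one E (G := G)).comp_of_point_eq
      (hT.comp_of_point_eq (hasMFDerivAt_extChartAt_symm_one F (G := H)) (by simp)) (by simp)
    have h3 : (fun y => slice j P (y, 0)) = fun y => extChartAt 𝓘(ℝ, E) (1 : G)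
        (j ((extChartAt 𝓘(ℝ, F) (1 : H)).symm y)) := by
      ext y; simp [slice]
    rw [h3] at h1
    rw [h1.unique (hasMFDerivAt_iff_hasFDerivAt.1 h2)]
    ext X
    simp
    rfl
  · have h1 : HasFDerivAt (fun s => slice j P (extChartAt 𝓘(ℝ, F) (1 : H) 1, s)) _ (0 : P) :=
      HasFDerivAt.comp (g := slice j P) (0 : P) hd (hasFDerivAt_prodMk_right _ _)
    have h2 : HasFDerivAt (fun s : P => extChartAt 𝓘(ℝ, E) (1 : G) 1 + (s : E)) P.subtypeL 0 :=
      P.subtypeL.hasFDerivAt.const_add _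
    have h3 : (fun s => slice j P (extChartAt 𝓘(ℝ, F) (1 : H) 1, s)) =ᶠ[𝓝 0]
        fun s : P => extChartAt 𝓘(ℝ, E) (1 : G) 1 + (s : E) := by
      have hc : Tendsto (fun s : P => extChartAt 𝓘(ℝ, E) (1 : G) 1 + (s : E)) (𝓝 0)
          (𝓝 (extChartAt 𝓘(ℝ, E) (1 : G) 1)) :=
        Continuous.tendsto' (by fun_prop) _ _ (by simp)
      filter_upwards [hc (extChartAt_target_mem_nhds (I := 𝓘(ℝ, E)) (1 : G))] with s hs
      have h4 := (extChartAt 𝓘(ℝ, E) (1 : G)).right_inv hs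
      simp only [slice, extChartAt_to_inv, map_one, mul_one]
      exact h4
    rw [h1.unique (h2.congr_of_eventuallyEq h3)]
    ext X; simp

/-- Near the identity there is a differentiable function whose level sets are unions of pieces of
left cosets of the subgroup, and whose level set through the identity lies in the subgroup. -/
theorem exists_transverse_function [FiniteDimensional ℝ E] [FiniteDimensional ℝ F]
    (hj : ContMDiff 𝓘(ℝ, F) 𝓘(ℝ, E) ω j)
    (hT : HasMFDerivAt 𝓘(ℝ, F) 𝓘(ℝ, E) j (1 : H) T) (hinj : Function.Injective T) :
    ∃ (P : Submodule ℝ E) (q : G → P),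
      (∀ᶠ g in 𝓝 (1 : G), MDifferentiableAt 𝓘(ℝ, E) 𝓘(ℝ, P) q g) ∧
      (∀ᶠ g in 𝓝 (1 : G), ∀ᶠ x in 𝓝 (1 : H), q (g * j x) = q g) ∧
      (∀ᶠ g in 𝓝 (1 : G), q g = q 1 → g ∈ j.range) := by
  have hmanE : IsManifold 𝓘(ℝ, E) 1 G := IsManifold.of_le (n := ω) (by simp)
  obtain ⟨P, hP⟩ := (T : F →ₗ[ℝ] E).range.exists_isCompl
  set e := extChartAt 𝓘(ℝ, E) (1 : G) 1 with he
  set y₀ := extChartAt 𝓘(ℝ, F) (1 : H) 1 with hy₀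
  have hbij : Function.Bijective (T.coprod P.subtypeL) := by
    constructor
    · rw [injective_iff_map_eq_zero]
      rintro ⟨y, s⟩ h
      have h' : T y = -(s : E) := eq_neg_of_add_eq_zero_left (by simpa using h)
      have h0 : T y = 0 := (Submodule.disjoint_def.1 hP.disjoint) _ ⟨y, rfl⟩
        (h' ▸ neg_mem s.2)
      have hy : y = 0 := hinj (by rw [h0, map_zero])
      have hs : s = 0 := by
        rw [h0, eq_comm, neg_eq_zero] at h'
        exact Subtype.ext h'
      rw [hy, hs]; rfl
    · intro v
      obtain ⟨_, ⟨y, rfl⟩, s, hs, rfl⟩ := Submodule.mem_sup.1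
        (hP.sup_eq_top ▸ Submodule.mem_top : v ∈ (T : F →ₗ[ℝ] E).range ⊔ P)
      exact ⟨(y, ⟨s, hs⟩), by simp⟩
  let L : (F × P) ≃L[ℝ] E :=
    (LinearEquiv.ofBijective (T.coprod P.subtypeL : (F × P) →ₗ[ℝ] E) hbij).toContinuousLinearEquiv
  have hL : (L : (F × P) →L[ℝ] E) = T.coprod P.subtypeL := by ext p <;> rfl
  have hcd := contDiffAt_slice hj P
  have hs : HasFDerivAt (slice j P) (L : (F × P) →L[ℝ] E) (y₀, 0) := by
    rw [hL, ← fderiv_slice hj hT P]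
    exact (hcd.differentiableAt (by simp)).hasFDerivAt
  have hst : HasStrictFDerivAt (slice j P) (L : (F × P) →L[ℝ] E) (y₀, 0) :=
    hcd.hasStrictFDerivAt' hs (by simp)
  set inv := hst.localInverse with hinv
  have hinvd : ContDiffAt ℝ ω inv e := by
    have := hcd.to_localInverse hs (by simp)
    rwa [slice_one] at this
  have hleft : ∀ᶠ p in 𝓝 (y₀, (0 : P)), inv (slice j P p) = p := hst.eventually_left_inverse
  have hright : ∀ᶠ z in 𝓝 e, slice j P (inv z) = z := by
    have := hst.eventually_right_inverse
    rwa [slice_one] at this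
  have hinve : inv e = (y₀, 0) := by
    have := hleft.self_of_nhds
    rwa [slice_one] at this
  have hgood : ∀ᶠ p in 𝓝 (y₀, (0 : P)), inv (slice j P p) = p ∧
      p.1 ∈ (extChartAt 𝓘(ℝ, F) (1 : H)).target ∧
      (extChartAt 𝓘(ℝ, E) (1 : G)).symm (e + p.2) *
        j ((extChartAt 𝓘(ℝ, F) (1 : H)).symm p.1) ∈ (extChartAt 𝓘(ℝ, E) (1 : G)).source := by
    refine hleft.and (Filter.Eventually.and ?_ ?_)
    · exact (continuous_fst.tendsto (y₀, (0 : P)))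
        (extChartAt_target_mem_nhds (I := 𝓘(ℝ, F)) (1 : H))
    · have : ContinuousAt (fun p : F × P => (extChartAt 𝓘(ℝ, E) (1 : G)).symm (e + p.2) *
        j ((extChartAt 𝓘(ℝ, F) (1 : H)).symm p.1)) (y₀, 0) := by
        have : IsTopologicalGroup G := topologicalGroup_of_lieGroup 𝓘(ℝ, E) ω
        refine ContinuousAt.mul ?_ ?_
        · refine ContinuousAt.comp_of_eq (y := e)
            (contMDiffAt_extChartAt_symm_one E G).continuousAt ?_ (by simp)
          fun_prop
        · refine hj.continuous.continuousAt.comp (ContinuousAt.comp_of_eq (y := y₀)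
            (contMDiffAt_extChartAt_symm_one F H).continuousAt continuousAt_fst rfl)
      refine this.preimage_mem_nhds ?_
      simp only [hy₀, he, Submodule.coe_zero, add_zero, extChartAt_to_inv, map_one, mul_one]
      exact extChartAt_source_mem_nhds (I := 𝓘(ℝ, E)) (1 : G)
  have hφ : Tendsto (extChartAt 𝓘(ℝ, E) (1 : G)) (𝓝 1) (𝓝 e) :=
    (continuousAt_extChartAt (I := 𝓘(ℝ, E)) (1 : G)).tendsto
  have hinvφ : Tendsto (fun g : G => inv (extChartAt 𝓘(ℝ, E) (1 : G) g)) (𝓝 1) (𝓝 (y₀, 0)) :=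
    (hinve ▸ hinvd.continuousAt.tendsto).comp hφ
  have hdecomp : ∀ᶠ g in 𝓝 (1 : G), g = (extChartAt 𝓘(ℝ, E) (1 : G)).symm
      (e + (inv (extChartAt 𝓘(ℝ, E) (1 : G) g)).2) *
      j ((extChartAt 𝓘(ℝ, F) (1 : H)).symm (inv (extChartAt 𝓘(ℝ, E) (1 : G) g)).1) := by
    filter_upwards [hinvφ.eventually hgood, hφ.eventually hright,
      extChartAt_source_mem_nhds (I := 𝓘(ℝ, E)) (1 : G)] with g h1 h2 h3
    exact (extChartAt 𝓘(ℝ, E) (1 : G)).injOn h3 h1.2.2 h2.symm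
  -- Locally `g = σ(s) j(h)`, and `q` reads off `s`. Right multiplication by `j x` changes only `h`,
  -- and `s = 0` leaves `g = j(h)`.
  refine ⟨P, fun g => (inv (extChartAt 𝓘(ℝ, E) (1 : G) g)).2, ?_, ?_, ?_⟩
  · have h1 : ∀ᶠ z in 𝓝 e, DifferentiableAt ℝ inv z :=
      ((hinvd.of_le (m := 1) (by simp)).eventually (by simp)).mono
        fun _ h => h.differentiableAt (by simp)
    filter_upwards [hφ.eventually h1, chart_source_mem_nhds E (1 : G)] with g hg hg'
    exact MDifferentiableAt.comp (I' := 𝓘(ℝ, E)) g (g := fun z => (inv z).2)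
      (hg.snd).mdifferentiableAt (mdifferentiableAt_extChartAt hg')
  · filter_upwards [hinvφ.eventually hgood.eventually_nhds, hdecomp] with g hg hg'
    have : IsTopologicalGroup H := topologicalGroup_of_lieGroup 𝓘(ℝ, F) ω
    set p := inv (extChartAt 𝓘(ℝ, E) (1 : G) g) with hp
    set h := (extChartAt 𝓘(ℝ, F) (1 : H)).symm p.1 with hh
    have hpt := hg.self_of_nhds.2.1
    have hhs : h ∈ (extChartAt 𝓘(ℝ, F) (1 : H)).source :=
      (extChartAt 𝓘(ℝ, F) (1 : H)).map_target hpt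
    have hmul : Tendsto (fun x : H => h * x) (𝓝 1) (𝓝 h) :=
      Continuous.tendsto' (by fun_prop) _ _ (by simp)
    have hψ : Tendsto (fun x : H => extChartAt 𝓘(ℝ, F) (1 : H) (h * x)) (𝓝 1) (𝓝 p.1) := by
      have := (continuousAt_extChartAt' (I := 𝓘(ℝ, F)) hhs).tendsto.comp hmul
      rwa [hh, (extChartAt 𝓘(ℝ, F) (1 : H)).right_inv hpt] at this
    have hψ' : Tendsto (fun x : H => (extChartAt 𝓘(ℝ, F) (1 : H) (h * x), p.2)) (𝓝 1) (𝓝 p) :=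
      hψ.prodMk_nhds tendsto_const_nhds
    filter_upwards [hψ'.eventually hg, hmul ((isOpen_extChartAt_source (1 : H)).mem_nhds hhs)]
      with x hx hx'
    have h1 : slice j P (extChartAt 𝓘(ℝ, F) (1 : H) (h * x), p.2) =
        extChartAt 𝓘(ℝ, E) (1 : G) (g * j x) := by
      simp only [slice]
      rw [(extChartAt 𝓘(ℝ, F) (1 : H)).left_inv hx', map_mul, ← mul_assoc]
      conv_rhs => rw [hg']
    rw [← h1, hx.1]
  · filter_upwards [hdecomp] with g hg hq
    have h1 : (inv (extChartAt 𝓘(ℝ, E) (1 : G) 1)).2 = 0 := by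
      rw [← he, hinve]
    rw [h1] at hq
    have h2 : (extChartAt 𝓘(ℝ, E) (1 : G)).symm (e + ((0 : P) : E)) = 1 := by simp [he]
    rw [hq, h2, one_mul] at hg
    exact ⟨_, hg.symm⟩

theorem _root_.HasMFDerivAt.comp_eq_zero_of_left {E E' E'' : Type*}
    [NormedAddCommGroup E] [NormedSpace ℝ E]
    [NormedAddCommGroup E'] [NormedSpace ℝ E'] [NormedAddCommGroup E''] [NormedSpace ℝ E'']
    {M M' M'' : Type*} [TopologicalSpace M] [ChartedSpace E M] [TopologicalSpace M']
    [ChartedSpace E' M'] [TopologicalSpace M''] [ChartedSpace E'' M'']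
    {f : M → M'} {g : M' → M''} {x : M} {y : M'}
    (hg : HasMFDerivAt 𝓘(ℝ, E') 𝓘(ℝ, E'') g y (0 : E' →L[ℝ] E''))
    (hf : MDifferentiableAt 𝓘(ℝ, E) 𝓘(ℝ, E') f x)
    (h : f x = y) :
    HasMFDerivAt 𝓘(ℝ, E) 𝓘(ℝ, E'') (fun z => g (f z)) x (0 : E →L[ℝ] E'') := by
  obtain ⟨f', hf'⟩ : ∃ f' : E →L[ℝ] E', HasMFDerivAt 𝓘(ℝ, E) 𝓘(ℝ, E') f x f' :=
    ⟨_, hf.hasMFDerivAt⟩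
  have h0 : (0 : E' →L[ℝ] E'') ∘L f' = 0 := by ext1 X; rfl
  exact h0 ▸ hg.comp_of_point_eq hf' h

theorem eventually_const_of_hasMFDerivAt_zero {V : Type*} [NormedAddCommGroup V] [NormedSpace ℝ V]
    {f : H → V} (hf : ∀ᶠ x in 𝓝 (1 : H), HasMFDerivAt 𝓘(ℝ, F) 𝓘(ℝ, V) f x (0 : F →L[ℝ] V)) :
    ∀ᶠ x in 𝓝 (1 : H), f x = f 1 := by
  have hman : IsManifold 𝓘(ℝ, F) 1 H := IsManifold.of_le (n := ω) (by simp)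
  have hc := (contMDiffAt_extChartAt_symm_one F H).continuousAt.tendsto
  rw [extChartAt_to_inv] at hc
  have h1 : ∀ᶠ y in 𝓝 (extChartAt 𝓘(ℝ, F) (1 : H) 1),
      HasFDerivAt (f ∘ (extChartAt 𝓘(ℝ, F) (1 : H)).symm) (0 : F →L[ℝ] V) y := by
    filter_upwards [hc.eventually hf, extChartAt_target_mem_nhds (I := 𝓘(ℝ, F)) (1 : H)]
      with y hy hyt
    have h2 := (mdifferentiableWithinAt_extChartAt_symm (I := 𝓘(ℝ, F)) hyt).mdifferentiableAt
      (by simp)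
    exact hasMFDerivAt_iff_hasFDerivAt.1 (hy.comp_eq_zero_of_left h2 rfl)
  obtain ⟨ε, hε, hball⟩ := Metric.eventually_nhds_iff_ball.1 h1
  have hφ := (continuousAt_extChartAt (I := 𝓘(ℝ, F)) (1 : H)).tendsto
  filter_upwards [hφ (Metric.ball_mem_nhds _ hε),
    eventually_extChartAt_symm_extChartAt (E := F) (1 : H)] with x hx hx'
  have h4 := (convex_ball (extChartAt 𝓘(ℝ, F) (1 : H) 1) ε).is_const_of_fderivWithin_eq_zero
    (𝕜 := ℝ) (f := f ∘ (extChartAt 𝓘(ℝ, F) (1 : H)).symm)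
    (fun y hy => (hball y hy).differentiableAt.differentiableWithinAt)
    (fun y hy => by
      rw [fderivWithin_of_isOpen Metric.isOpen_ball hy]
      exact (hball y hy).fderiv) hx (Metric.mem_ball_self hε)
  have h5 : f ((extChartAt 𝓘(ℝ, F) (1 : H)).symm (extChartAt 𝓘(ℝ, F) (1 : H) x)) =
    f ((extChartAt 𝓘(ℝ, F) (1 : H)).symm (extChartAt 𝓘(ℝ, F) (1 : H) 1)) := h4
  rwa [hx', extChartAt_to_inv] at h5

/-- If conjugation by `a` preserves the Lie algebra of a Lie subgroup, it carries elements close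
to the identity into the subgroup. -/
theorem eventually_conj_mem_range [FiniteDimensional ℝ E] [FiniteDimensional ℝ F]
    (hj : ContMDiff 𝓘(ℝ, F) 𝓘(ℝ, E) ω j)
    (hT : HasMFDerivAt 𝓘(ℝ, F) 𝓘(ℝ, E) j (1 : H) T) (hinj : Function.Injective T) {a : G}
    (ha : (T : F →ₗ[ℝ] E).range.map (Ad E a : E →ₗ[ℝ] E) ≤ (T : F →ₗ[ℝ] E).range) :
    ∀ᶠ x in 𝓝 (1 : H), a * j x * a⁻¹ ∈ j.range := by
  have : IsTopologicalGroup G := topologicalGroup_of_lieGroup 𝓘(ℝ, E) ω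
  obtain ⟨P, q, hq1, hq2, hq3⟩ := exists_transverse_function hj hT hinj
  set c : H → G := fun x => a * j x * a⁻¹ with hc
  have hc1 : c 1 = 1 := by simp [hc]
  have hcmul : ∀ x y, c (x * y) = c x * c y := fun x y => by simp [hc, mul_assoc]
  have hct : Tendsto c (𝓝 1) (𝓝 1) := by
    rw [← hc1]
    refine Continuous.tendsto ?_ 1
    have := hj.continuous
    fun_prop
  have hcd : HasMFDerivAt 𝓘(ℝ, F) 𝓘(ℝ, E) c (1 : H) (Ad E a ∘L T) :=
    (hasMFDerivAt_conj E a).comp_of_point_eq hT (map_one j)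
  -- Translate to the identity by `c y = c x * c (x⁻¹ * y)`. The derivative of `g ↦ q (c x * g)`
  -- kills the range of `T`, since `q` is constant along left cosets, and `Ad a` keeps that range
  -- inside itself.
  have hzero : ∀ᶠ x in 𝓝 (1 : H),
      HasMFDerivAt 𝓘(ℝ, F) 𝓘(ℝ, P) (fun y => q (c y)) x (0 : F →L[ℝ] P) := by
    filter_upwards [hct.eventually hq1, hct.eventually hq2] with x h1 h2
    have hmul : MDifferentiableAt 𝓘(ℝ, E) 𝓘(ℝ, E) (fun g : G => c x * g) 1 :=
      (contMDiff_mul_left (I := 𝓘(ℝ, E)) (n := ω)).mdifferentiableAt (by simp)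
    let Q : E →L[ℝ] P := mfderiv 𝓘(ℝ, E) 𝓘(ℝ, P) q (c x) ∘L
      mfderiv 𝓘(ℝ, E) 𝓘(ℝ, E) (fun g : G => c x * g) 1
    have hQ : HasMFDerivAt 𝓘(ℝ, E) 𝓘(ℝ, P) (fun g : G => q (c x * g)) 1 Q :=
      h1.hasMFDerivAt.comp_of_point_eq hmul.hasMFDerivAt (mul_one _)
    have hQT : Q ∘L T = 0 :=
      hasMFDerivAt_unique (hQ.comp_of_point_eq hT (map_one j))
        ((hasMFDerivAt_const (q (c x)) (1 : H)).congr_of_eventuallyEq h2)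
    have h3 : HasMFDerivAt 𝓘(ℝ, F) 𝓘(ℝ, P) (fun y => q (c x * c y)) 1 (0 : F →L[ℝ] P) := by
      have hz : Q ∘L (Ad E a ∘L T) = 0 := by
        ext1 X
        obtain ⟨Y, hY⟩ := ha ⟨T X, ⟨X, rfl⟩, rfl⟩
        exact (congrArg Q hY).symm.trans (congrArg (fun L : F →L[ℝ] P => L Y) hQT)
      exact hz ▸ hQ.comp_of_point_eq hcd hc1
    have h5 : MDifferentiableAt 𝓘(ℝ, F) 𝓘(ℝ, F) (fun y : H => x⁻¹ * y) x :=
      (contMDiff_mul_left (I := 𝓘(ℝ, F)) (n := ω)).mdifferentiableAt (by simp)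
    have h6 := h3.comp_eq_zero_of_left h5 (inv_mul_cancel x)
    refine h6.congr_of_eventuallyEq (.of_forall fun y => ?_)
    simp only
    rw [← hcmul, mul_inv_cancel_left]
  filter_upwards [eventually_const_of_hasMFDerivAt_zero hzero, hct.eventually hq3] with x h1 h2
  exact h2 (by rw [h1, hc1])

/-- `Ad a` is injective, so the inclusion is an equality by dimension. This supplies the second
inclusion needed for membership in the normalizer. -/
theorem map_Ad_inv_of_map_Ad [FiniteDimensional ℝ E] {S : Submodule ℝ E} {a : G}
    (ha : S.map (Ad E a : E →ₗ[ℝ] E) ≤ S) : S.map (Ad E a⁻¹ : E →ₗ[ℝ] E) ≤ S := by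
  have hinv : ∀ v, Ad E a⁻¹ (Ad E a v) = v := fun v => by
    rw [← ContinuousLinearMap.comp_apply, ← Ad_mul, inv_mul_cancel, Ad_one]
    rfl
  have hinj : Function.Injective (Ad E a : E →ₗ[ℝ] E) := fun v w h => by
    rw [← hinv v, ← hinv w]
    exact congrArg _ h
  have heq := Submodule.eq_of_le_of_finrank_eq ha
    (LinearEquiv.finrank_eq (Submodule.equivMapOfInjective _ hinj S)).symm
  conv_lhs => rw [← heq]
  rintro _ ⟨_, ⟨v, hv, rfl⟩, rfl⟩
  have := hinv v
  exact this.symm ▸ hv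

/-- An element whose adjoint action preserves the Lie algebra of a connected Lie subgroup
normalizes the subgroup. -/
theorem mem_normalizer_of_map_Ad_le [FiniteDimensional ℝ E] [FiniteDimensional ℝ F]
    {K : Subgroup G} [ChartedSpace F K] [LieGroup 𝓘(ℝ, F) ω K] [PreconnectedSpace K]
    (hK : ContMDiff 𝓘(ℝ, F) 𝓘(ℝ, E) ω (Subtype.val : K → G)) {T : F →L[ℝ] E}
    (hT : HasMFDerivAt 𝓘(ℝ, F) 𝓘(ℝ, E) (Subtype.val : K → G) (1 : K) T)
    (hinj : Function.Injective T) {a : G}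
    (ha : (T : F →ₗ[ℝ] E).range.map (Ad E a : E →ₗ[ℝ] E) ≤ (T : F →ₗ[ℝ] E).range) :
    a ∈ Subgroup.normalizer (K : Set G) := by
  have : IsTopologicalGroup K := topologicalGroup_of_lieGroup 𝓘(ℝ, F) ω
  have key : ∀ b : G, (T : F →ₗ[ℝ] E).range.map (Ad E b : E →ₗ[ℝ] E) ≤ (T : F →ₗ[ℝ] E).range →
      ∀ x ∈ K, b * x * b⁻¹ ∈ K := by
    intro b hb x hx
    have h1 := eventually_conj_mem_range (j := K.subtype) hK hT hinj hb
    rw [Subgroup.range_subtype] at h1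
    -- The elements of `K` that conjugation by `b` sends into `K` form a subgroup containing a
    -- neighbourhood of `1`; `K` is connected.
    have h2 : (K.comap (MulAut.conj b).toMonoidHom).subgroupOf K = ⊤ :=
      subgroup_eq_top_of_mem_nhds_one _ h1
    exact (h2 ▸ Subgroup.mem_top (⟨x, hx⟩ : K) :
      (⟨x, hx⟩ : K) ∈ (K.comap (MulAut.conj b).toMonoidHom).subgroupOf K)
  rw [Subgroup.mem_normalizer_iff]
  intro x
  refine ⟨key a ha x, fun h => ?_⟩
  have := key a⁻¹ (map_Ad_inv_of_map_Ad ha) _ h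
  simpa [mul_assoc] using this

end Normalizer

end OrbitalMeasure

namespace OrbitalMeasure

/-! ### Null sets under submersions and in charts -/

section NullSets

open Filter Topology

/-- Near a point where its strict derivative is onto, a map pulls null sets back to null sets. -/
theorem exists_mem_nhds_forall_measure_inter_preimage_eq_zero
    {E F : Type*} [NormedAddCommGroup E] [NormedSpace ℝ E] [FiniteDimensional ℝ E]
    [MeasurableSpace E] [BorelSpace E] [NormedAddCommGroup F] [NormedSpace ℝ F]
    [FiniteDimensional ℝ F] [MeasurableSpace F] [BorelSpace F]
    (μ : Measure E) [μ.IsAddHaarMeasure] (ν : Measure F) [ν.IsAddHaarMeasure]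
    {f : E → F} {f' : E →L[ℝ] F} {x : E} (hf : HasStrictFDerivAt f f' x)
    (hsurj : Function.Surjective f') :
    ∃ V ∈ 𝓝 x, ∀ N : Set F, ν N = 0 → μ (V ∩ f ⁻¹' N) = 0 := by
  obtain ⟨A, hA⟩ := (f' : E →ₗ[ℝ] F).exists_rightInverse_of_surjective
    (LinearMap.range_eq_top.2 hsurj)
  have hA' : ∀ v, f' (A v) = v := fun v => LinearMap.congr_fun hA v
  -- The map `g` straightens `f`: `f' ∘ g = f` because `A` is a right inverse of `f'`, and `g` has
  -- derivative the identity at `x`. The problem reduces to the linear surjection `f'`.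
  set g : E → E := fun z => z + A.toContinuousLinearMap (f z - f' z) with hg
  have hg' : HasStrictFDerivAt g (ContinuousLinearMap.id ℝ E) x := by
    have h1 := (hasStrictFDerivAt_id (𝕜 := ℝ) x).add
      (A.toContinuousLinearMap.hasStrictFDerivAt.comp x (hf.sub f'.hasStrictFDerivAt))
    have h2 : ContinuousLinearMap.id ℝ E + A.toContinuousLinearMap ∘L (f' - f') =
        ContinuousLinearMap.id ℝ E := by simp
    rw [h2] at h1
    exact h1
  have hfg : ∀ z, f' (g z) = f z := fun z => by simp [hg, hA']
  -- Any positive constant below `1 = |det id|` would do; near `x` it gives `μ (g '' s) ≥ μ s / 2`.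
  have hdet : ((1 / 2 : NNReal) : ENNReal) <
      ENNReal.ofReal |(ContinuousLinearMap.id ℝ E).det| := by
    have : (ContinuousLinearMap.id ℝ E).det = 1 := LinearMap.det_id
    rw [this, abs_one, ENNReal.ofReal_one]
    exact_mod_cast (by norm_num : (1 / 2 : NNReal) < 1)
  obtain ⟨δ, hδ, hδ0⟩ :=
    ((mul_le_addHaar_image_of_lt_det μ (ContinuousLinearMap.id ℝ E) hdet).and
      self_mem_nhdsWithin).exists
  obtain ⟨V, hV, happ⟩ := hg'.approximates_deriv_on_nhds (c := δ) (.inr hδ0)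
  refine ⟨V, hV, fun N hN => ?_⟩
  obtain ⟨c, -, hcmap⟩ :=
    (f' : E →ₗ[ℝ] F).exists_map_addHaar_eq_smul_addHaar μ ν hsurj
  have hN' : μ (f' ⁻¹' N) = 0 := by
    have : Measure.map f' μ N = 0 := by
      change Measure.map (f' : E →ₗ[ℝ] F) μ N = 0
      rw [hcmap]
      simp [hN]
    refine le_antisymm ((Measure.le_map_apply f'.continuous.aemeasurable N).trans this.le) bot_le
  have h2 := hδ (V ∩ f ⁻¹' N) g (happ.mono_set Set.inter_subset_left)
  have h3 : μ (g '' (V ∩ f ⁻¹' N)) = 0 := by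
    refine measure_mono_null ?_ hN'
    rintro _ ⟨z, ⟨-, hz⟩, rfl⟩
    simpa [hfg] using hz
  rw [h3, nonpos_iff_eq_zero, mul_eq_zero] at h2
  exact h2.resolve_left (by simp)

/-- `φ` is a chart of the group `G` at the identity, with inverse `ψ`, in which left translations
are differentiable. -/
structure IsDifferentiableChart {G : Type*} [Group G] [TopologicalSpace G] {E : Type*}
    [NormedAddCommGroup E] [NormedSpace ℝ E] (φ : G → E) (ψ : E → G) : Prop where
  map_one : ψ (φ 1) = 1
  left_inv : ∀ᶠ g in 𝓝 (1 : G), ψ (φ g) = g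
  right_inv : ∀ᶠ y in 𝓝 (φ 1), φ (ψ y) = y
  continuousAt : ContinuousAt φ 1
  continuousAt_symm : ∀ᶠ y in 𝓝 (φ 1), ContinuousAt ψ y
  differentiableAt : ∀ᶠ p in 𝓝 ((1 : G), φ 1), DifferentiableAt ℝ (fun z => φ (p.1 * ψ z)) p.2

section Chart

variable {G : Type*} [Group G] [TopologicalSpace G] [IsTopologicalGroup G] {E : Type*}
    [NormedAddCommGroup E] [NormedSpace ℝ E] [FiniteDimensional ℝ E]
    [MeasurableSpace E] [BorelSpace E] {φ : G → E} {ψ : E → G}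

namespace IsDifferentiableChart

/-- In the chart, left translation by `g` is inverted by the differentiable map `z ↦ φ (g⁻¹ * ψ z)`,
and differentiable maps preserve null sets. The neighbourhoods do not depend on `g` or `A`, as the
Fubini arguments below require. -/
theorem exists_forall_measure_translate_eq_zero (h : IsDifferentiableChart φ ψ) (ν : Measure E)
    [ν.IsAddHaarMeasure] {B₁ : Set E} (hB₁ : B₁ ∈ 𝓝 (φ 1)) :
    ∃ W ∈ 𝓝 (1 : G), ∃ B ∈ 𝓝 (φ 1), ∀ g ∈ W, ∀ A : Set G,
      ν {z ∈ B₁ | ψ z ∈ A} = 0 → ν {y ∈ B | g * ψ y ∈ A} = 0 := by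
  obtain ⟨W₂, hW₂, B₂, hB₂, hsub⟩ := mem_nhds_prod_iff.1 h.differentiableAt
  have hmul : Tendsto (fun p : G × E => p.1 * ψ p.2) (𝓝 (1, φ 1)) (𝓝 1) := by
    have h1 : ContinuousAt ψ (φ 1) := h.continuousAt_symm.self_of_nhds
    have h2 : ContinuousAt (fun p : G × E => p.1 * ψ p.2) (1, φ 1) :=
      continuousAt_fst.mul (h1.comp_of_eq continuousAt_snd rfl)
    simpa [ContinuousAt, h.map_one] using h2
  have hφ : Tendsto (fun p : G × E => φ (p.1 * ψ p.2)) (𝓝 (1, φ 1)) (𝓝 (φ 1)) :=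
    h.continuousAt.tendsto.comp hmul
  have hev : ∀ᶠ p in 𝓝 ((1 : G), φ 1), ψ (φ (p.1 * ψ p.2)) = p.1 * ψ p.2 ∧
      φ (p.1 * ψ p.2) ∈ B₁ ∩ B₂ ∧ φ (ψ p.2) = p.2 ∧ p.1⁻¹ ∈ W₂ :=
    (hmul.eventually h.left_inv).and ((hφ.eventually (inter_mem hB₁ hB₂)).and
      ((continuousAt_snd.eventually h.right_inv).and
        ((continuousAt_fst.inv (x := ((1 : G), φ 1))).eventually
          (show ∀ᶠ g in 𝓝 ((1 : G), φ 1).1⁻¹, g ∈ W₂ by simpa using hW₂))))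
  obtain ⟨W, hW, B, hB, hWB⟩ := mem_nhds_prod_iff.1 hev
  refine ⟨W, hW, B, hB, fun g hg A hA => ?_⟩
  have hnull : ν {z ∈ B₁ ∩ B₂ | ψ z ∈ A} = 0 := by
    refine measure_mono_null (fun z hz => ?_) hA
    exact ⟨hz.1.1, hz.2⟩
  refine measure_mono_null ?_ (addHaar_image_eq_zero_of_differentiableOn_of_addHaar_eq_zero ν
    (f := fun z => φ (g⁻¹ * ψ z)) ?_ hnull)
  · rintro y ⟨hy, hyA⟩
    obtain ⟨h1, h2, h3, -⟩ := hWB (Set.mk_mem_prod hg hy)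
    refine ⟨φ (g * ψ y), ⟨h2, ?_⟩, ?_⟩
    · rw [h1]
      exact hyA
    · simp only at h1 ⊢
      rw [h1, inv_mul_cancel_left]
      exact h3
  · intro z hz
    obtain ⟨-, -, -, h4⟩ := hWB (Set.mk_mem_prod hg (mem_of_mem_nhds hB))
    exact (hsub (Set.mk_mem_prod h4 hz.1.2)).differentiableWithinAt

variable [MeasurableSpace G] [BorelSpace G] [SecondCountableTopology G]

omit [NormedSpace ℝ E] [FiniteDimensional ℝ E] in
theorem _root_.ContinuousOn.measurableSet_mul_mem [SecondCountableTopology E]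
    {B : Set E} (hB : IsOpen B) (hψ : ContinuousOn ψ B) {W : Set G} (hW : IsOpen W) {A : Set G}
    (hA : MeasurableSet A) :
    MeasurableSet {p : G × E | p.1 ∈ W ∧ p.2 ∈ B ∧ p.1 * ψ p.2 ∈ A} := by
  classical
  -- The value `1` off `B` is arbitrary; it only makes `ψ` globally measurable.
  have h1 : Measurable (B.piecewise ψ fun _ => 1) :=
    hψ.measurable_piecewise continuousOn_const hB.measurableSet
  have h2 : Measurable fun p : G × E => p.1 * B.piecewise ψ (fun _ => 1) p.2 :=
    measurable_fst.mul (h1.comp measurable_snd)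
  have h3 := ((hW.prod hB).measurableSet).inter (h2 hA)
  convert h3 using 1
  ext p
  simp only [Set.mem_ofPred_eq, Set.mem_inter_iff, Set.mem_prod, Set.mem_preimage, and_assoc]
  refine and_congr_right fun _ => and_congr_right fun hp => ?_
  rw [Set.piecewise_eq_of_mem _ _ _ hp]

variable (μ : Measure G) [IsFiniteMeasure μ] [μ.IsHaarMeasure]

/-- Fubini for `{(g, y) | g * ψ y ∈ A}`: for fixed `y` the section lies in a right translate of `A`,
which is null, so for almost every `g` the section in `y` is null. Choose such a `g` near `1` and
translate back. -/
theorem exists_mem_nhds_measure_chart_eq_zero (h : IsDifferentiableChart φ ψ) (ν : Measure E)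
    [ν.IsAddHaarMeasure] {A : Set G} (hA : MeasurableSet A) (hA0 : μ A = 0) :
    ∃ B ∈ 𝓝 (φ 1), ν {y ∈ B | ψ y ∈ A} = 0 := by
  have : ProperSpace E := FiniteDimensional.proper_real E
  obtain ⟨B₁, hB₁s, hB₁o, hB₁⟩ := eventually_nhds_iff.1 h.continuousAt_symm
  obtain ⟨W, hW, B, hB, hWB⟩ :=
    h.exists_forall_measure_translate_eq_zero ν (hB₁o.mem_nhds hB₁)
  have hW' : W⁻¹ ∈ 𝓝 (1 : G) := inv_mem_nhds_one _ hW
  obtain ⟨W₁, hW₁s, hW₁o, hW₁⟩ := mem_nhds_iff.1 hW'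
  have hmeas := ContinuousOn.measurableSet_mul_mem hB₁o
    (fun y hy => (hB₁s y hy).continuousWithinAt) hW₁o hA
  have h0 : ∀ᵐ g ∂μ, ∀ᵐ y ∂ν, ¬(g ∈ W₁ ∧ y ∈ B₁ ∧ g * ψ y ∈ A) := by
    refine (Measure.ae_ae_comm hmeas.compl).2 (.of_forall fun y => ?_)
    refine measure_mono_null (fun g hg => ?_) ((measure_mul_right_null μ (ψ y)).2 hA0)
    exact (not_not.1 hg).2.2
  obtain ⟨g, hg0, hg⟩ := (Measure.dense_of_ae h0).inter_open_nonempty W₁ hW₁o ⟨1, hW₁⟩ |>.imp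
    fun g hg => And.symm hg
  refine ⟨B, hB, measure_mono_null (fun y hy => ?_)
    (hWB g⁻¹ (hW₁s hg) {u | g * u ∈ A} (measure_mono_null (fun y hy => ?_) hg0))⟩
  · exact ⟨hy.1, by simpa using hy.2⟩
  · exact not_not.2 ⟨hg, hy⟩

/-- The converse direction, with the roles in Fubini exchanged: the sections in `y` are null for
every `g` near `1`, so some section in `g` is null, and it is a right translate of `A` near the
identity. -/
theorem exists_mem_nhds_measure_inter_eq_zero (h : IsDifferentiableChart φ ψ) (ν : Measure E)
    [ν.IsAddHaarMeasure] {A : Set G} (hA : MeasurableSet A) {B₀ : Set E} (hB₀ : B₀ ∈ 𝓝 (φ 1))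
    (hA0 : ν {y ∈ B₀ | ψ y ∈ A} = 0) :
    ∃ W ∈ 𝓝 (1 : G), μ (W ∩ A) = 0 := by
  have : ProperSpace E := FiniteDimensional.proper_real E
  obtain ⟨W, hW, B, hB, hWB⟩ := h.exists_forall_measure_translate_eq_zero ν hB₀
  obtain ⟨W₁, hW₁s, hW₁o, hW₁⟩ := mem_nhds_iff.1 hW
  have hψW : ∀ᶠ y in 𝓝 (φ 1), ψ y ∈ W₁⁻¹ := by
    have h1 : ContinuousAt ψ (φ 1) := h.continuousAt_symm.self_of_nhds
    refine h1.eventually (hW₁o.inv.mem_nhds ?_)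
    simpa [h.map_one] using hW₁
  obtain ⟨B₁, hB₁s, hB₁o, hB₁⟩ :=
    eventually_nhds_iff.1 (h.continuousAt_symm.and (hψW.and (eventually_mem_set.2 hB)))
  have hmeas := ContinuousOn.measurableSet_mul_mem hB₁o
    (fun y hy => (hB₁s y hy).1.continuousWithinAt) hW₁o hA
  have h0 : ∀ᵐ y ∂ν, ∀ᵐ g ∂μ, ¬(g ∈ W₁ ∧ y ∈ B₁ ∧ g * ψ y ∈ A) := by
    refine (Measure.ae_ae_comm hmeas.compl).1 (.of_forall fun g => ?_)
    by_cases hg : g ∈ W₁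
    · refine measure_mono_null (fun y hy => ?_) (hWB g (hW₁s hg) A hA0)
      exact ⟨(hB₁s y (not_not.1 hy).2.1).2.2, (not_not.1 hy).2.2⟩
    · exact .of_forall fun y hy => hg hy.1
  obtain ⟨y, hy, hy0⟩ := (Measure.dense_of_ae h0).inter_open_nonempty B₁ hB₁o ⟨_, hB₁⟩
  refine ⟨(fun u => u * (ψ y)⁻¹) ⁻¹' W₁, ?_, ?_⟩
  · refine (hW₁o.preimage (continuous_mul_const _)).mem_nhds ?_
    simpa using (hB₁s y hy).2.1
  · rw [← measure_mul_right_null μ (ψ y)]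
    refine measure_mono_null (fun g hg => not_not.2 ⟨?_, hy, hg.2⟩) hy0
    simpa using hg.1

end IsDifferentiableChart

end Chart

theorem isDifferentiableChart_extChartAt {E : Type*} [NormedAddCommGroup E] [NormedSpace ℝ E]
    {G : Type*} [TopologicalSpace G] [ChartedSpace E G] [Group G] [LieGroup 𝓘(ℝ, E) ω G] :
    IsDifferentiableChart (extChartAt 𝓘(ℝ, E) (1 : G)) (extChartAt 𝓘(ℝ, E) (1 : G)).symm where
  map_one := extChartAt_to_inv _
  left_inv := eventually_extChartAt_symm_extChartAt _
  right_inv := by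
    filter_upwards [extChartAt_target_mem_nhds (I := 𝓘(ℝ, E)) (1 : G)] with y hy
    exact (extChartAt 𝓘(ℝ, E) (1 : G)).right_inv hy
  continuousAt := continuousAt_extChartAt _
  continuousAt_symm := by
    filter_upwards [extChartAt_target_mem_nhds (I := 𝓘(ℝ, E)) (1 : G)] with y hy
    exact continuousAt_extChartAt_symm'' hy
  differentiableAt := by
    have : IsTopologicalGroup G := topologicalGroup_of_lieGroup 𝓘(ℝ, E) ω
    have hman : IsManifold 𝓘(ℝ, E) 1 G := IsManifold.of_le (n := ω) (by simp)
    have h1 : ContinuousAt (fun p : G × E => p.1 * (extChartAt 𝓘(ℝ, E) (1 : G)).symm p.2)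
        (1, extChartAt 𝓘(ℝ, E) (1 : G) 1) :=
      continuousAt_fst.mul ((continuousAt_extChartAt_symm (1 : G)).comp_of_eq continuousAt_snd rfl)
    have h2 : ∀ᶠ p : G × E in 𝓝 (1, extChartAt 𝓘(ℝ, E) (1 : G) 1),
        p.1 * (extChartAt 𝓘(ℝ, E) (1 : G)).symm p.2 ∈ (chartAt E (1 : G)).source := by
      refine h1.eventually ((chartAt E (1 : G)).open_source.mem_nhds ?_)
      simp only [extChartAt_to_inv, mul_one]
      exact mem_chart_source E (1 : G)
    have h0 : ∀ᶠ p : G × E in 𝓝 (1, extChartAt 𝓘(ℝ, E) (1 : G) 1),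
        p.2 ∈ (extChartAt 𝓘(ℝ, E) (1 : G)).target :=
      continuousAt_snd (extChartAt_target_mem_nhds (I := 𝓘(ℝ, E)) (1 : G))
    filter_upwards [h2, h0]
      with p hp hpt
    have h3 := (mdifferentiableWithinAt_extChartAt_symm (I := 𝓘(ℝ, E)) hpt).mdifferentiableAt
      (by simp)
    have h4 : MDifferentiableAt 𝓘(ℝ, E) 𝓘(ℝ, E) (fun g : G => p.1 * g)
        ((extChartAt 𝓘(ℝ, E) (1 : G)).symm p.2) :=
      (contMDiff_mul_left (I := 𝓘(ℝ, E)) (n := ω)).mdifferentiableAt (by simp)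
    have h5 := mdifferentiableAt_extChartAt (I := 𝓘(ℝ, E)) hp
    exact mdifferentiableAt_iff_differentiableAt.1 (h5.comp p.2 (h4.comp p.2 h3))

/-- Lets the two preceding comparisons be used on `K^(r+1)` without putting a Lie group structure on
it. -/
theorem IsDifferentiableChart.pi {ι : Type*} [Fintype ι] {G : Type*} [Group G]
    [TopologicalSpace G] {E : Type*} [NormedAddCommGroup E] [NormedSpace ℝ E]
    {φ : G → E} {ψ : E → G} (h : IsDifferentiableChart φ ψ) :
    IsDifferentiableChart (fun (k : ι → G) i => φ (k i)) (fun (y : ι → E) i => ψ (y i)) where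
  map_one := funext fun _ => h.map_one
  left_inv := by
    have := eventually_all.2 fun i => ((continuous_apply i).tendsto (1 : ι → G)).eventually
      h.left_inv
    exact this.mono fun k hk => funext hk
  right_inv := by
    have := eventually_all.2 fun i => ((continuous_apply i).tendsto fun _ : ι => φ 1).eventually
      h.right_inv
    exact this.mono fun k hk => funext hk
  continuousAt := continuousAt_pi.2 fun i =>
    h.continuousAt.comp_of_eq (continuous_apply i).continuousAt rfl
  continuousAt_symm := by
    have := eventually_all.2 fun i => ((continuous_apply i).tendsto fun _ : ι => φ 1).eventually
      h.continuousAt_symm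
    exact this.mono fun y hy => continuousAt_pi.2 fun i =>
      (hy i).comp_of_eq (continuous_apply i).continuousAt rfl
  differentiableAt := by
    have hc : ∀ i, Tendsto (fun p : (ι → G) × (ι → E) => (p.1 i, p.2 i))
        (𝓝 (1, fun _ => φ 1)) (𝓝 (1, φ 1)) := fun i =>
      Continuous.tendsto (f := fun p : (ι → G) × (ι → E) => (p.1 i, p.2 i)) (by fun_prop) _
    have := eventually_all.2 fun i => (hc i).eventually h.differentiableAt
    refine this.mono fun p hp => differentiableAt_pi.2 fun i => ?_
    exact DifferentiableAt.comp (g := fun z => φ (p.1 i * ψ z)) p.2 (hp i)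
      (differentiableAt_apply i p.2)

end NullSets

end OrbitalMeasure

namespace OrbitalMeasure

/-! ### Combinatorics of the word -/

section Word

variable {U : Type*} [Group U] {K : Subgroup U} {r : ℕ}

/-- The product `k₁ a₁ k₂ a₂ ⋯ k_i a_i`. -/
def wordPrefix (a : Fin r → U) (k : Fin (r + 1) → K) : Fin (r + 1) → U :=
  Fin.partialProd fun j : Fin r => (k j.castSucc : U) * a j

theorem wordPrefix_zero (a : Fin r → U) (k : Fin (r + 1) → K) : wordPrefix a k 0 = 1 :=
  Fin.partialProd_zero _

theorem wordPrefix_succ (a : Fin r → U) (k : Fin (r + 1) → K) (j : Fin r) :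
    wordPrefix a k j.succ = wordPrefix a k j.castSucc * (k j.castSucc * a j) :=
  Fin.partialProd_succ _ _

theorem wordPrefix_succ_eq_tail (a : Fin (r + 1) → U) (k : Fin (r + 2) → K) (j : Fin (r + 1)) :
    wordPrefix a k j.succ = k 0 * a 0 * wordPrefix (Fin.tail a) (Fin.tail k) j :=
  Fin.partialProd_succ' _ _

/-- The prefix of index `l` uses only the letters `k j` with `j < l`, so `k i` is still free when
the prefixes up to `i` are fixed. -/
theorem wordPrefix_update (a : Fin r → U) (k : Fin (r + 1) → K) {i l : Fin (r + 1)} (h : l ≤ i)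
    (x : K) : wordPrefix a (Function.update k i x) l = wordPrefix a k l := by
  induction l using Fin.induction with
  | zero => simp only [wordPrefix_zero]
  | succ j ih =>
    have hj : j.castSucc < i := lt_of_lt_of_le j.castSucc_lt_succ h
    rw [wordPrefix_succ, wordPrefix_succ, ih hj.le, Function.update_of_ne hj.ne]

theorem word_zero (a : Fin 0 → U) (k : Fin 1 → K) : word a k = k 0 := by
  simp [word]

theorem word_succ (a : Fin (r + 1) → U) (k : Fin (r + 2) → K) :
    word a k = k 0 * a 0 * word (Fin.tail a) (Fin.tail k) := by
  simp only [word, List.ofFn_succ, List.prod_cons, mul_assoc]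
  rfl

/-- Perturbing one letter multiplies the word on the left by a conjugate of the perturbation;
infinitesimally, the `i`-th letter contributes `Ad (wordPrefix a k i * k i)` of the Lie algebra of
`K`. -/
theorem word_mul_mulSingle (a : Fin r → U) (k : Fin (r + 1) → K) (i : Fin (r + 1)) (x : K) :
    word a (k * Pi.mulSingle i x) =
      (wordPrefix a k i * k i) * x * (wordPrefix a k i * k i)⁻¹ * word a k := by
  induction r with
  | zero =>
    obtain rfl : i = 0 := Subsingleton.elim (α := Fin 1) i 0
    simp [word_zero, wordPrefix_zero]
  | succ r ih =>
    rw [word_succ, word_succ a k]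
    cases i using Fin.cases with
    | zero =>
      have : Fin.tail (k * Pi.mulSingle 0 x) = Fin.tail k := by
        ext j
        simp [Fin.tail]
      rw [this, wordPrefix_zero]
      simp [mul_assoc]
    | succ i =>
      have : Fin.tail (k * Pi.mulSingle i.succ x) = Fin.tail k * Pi.mulSingle i x := by
        ext j
        by_cases h : j = i
        · subst h
          simp [Fin.tail]
        · simp [Fin.tail, h]
      rw [this, ih, wordPrefix_succ_eq_tail]
      simp [mul_assoc, Fin.tail]

end Word

/-! ### Almost every word has full rank -/

section Rank

open Module

theorem measurable_finrank_range {X : Type*} [TopologicalSpace X] [MeasurableSpace X]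
    [OpensMeasurableSpace X] {E F : Type*} [NormedAddCommGroup E] [NormedSpace ℝ E]
    [NormedAddCommGroup F] [NormedSpace ℝ F] [FiniteDimensional ℝ F] {L : X → E →L[ℝ] F}
    (hL : Continuous L) : Measurable fun x => finrank ℝ (L x : E →ₗ[ℝ] F).range := by
  refine LowerSemicontinuous.measurable fun x n hn => ?_
  have key : ∀ y, ((n + 1 : ℕ) : Cardinal) ≤ (L y : E →ₗ[ℝ] F).rank ↔
      n < finrank ℝ (L y : E →ₗ[ℝ] F).range := fun y => by
    rw [LinearMap.rank, ← finrank_eq_rank, Nat.cast_le, Nat.succ_le_iff]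
  have hopen := (isOpen_setOfPred_nat_le_rank (𝕜 := ℝ) (E := E) (F := F) (n + 1)).preimage hL
  filter_upwards [hopen.mem_nhds ((key x).2 hn)] with y hy
  exact (key y).1 hy

theorem pi_eq_zero_of_forall_update {ι : Type*} [Fintype ι] [DecidableEq ι] {X : ι → Type*}
    [∀ i, MeasurableSpace (X i)] (μ : ∀ i, Measure (X i)) [∀ i, SigmaFinite (μ i)]
    {S : Set (∀ i, X i)} (hS : MeasurableSet S) (i : ι)
    (h : ∀ k, ∀ᵐ x ∂μ i, Function.update k i x ∉ S) : Measure.pi μ S = 0 := by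
  rw [← lintegral_indicator_one hS,
    lintegral_eq_of_lmarginal_eq {i} (g := 0) (measurable_one.indicator hS) measurable_const]
  · simp
  · simp only [lmarginal_singleton]
    funext k
    refine lintegral_congr_ae ?_
    filter_upwards [h k] with x hx
    simp [hx]

variable {E : Type*} [NormedAddCommGroup E] [NormedSpace ℝ E] [FiniteDimensional ℝ E]
  {G : Type*} [TopologicalSpace G] [ChartedSpace E G] [Group G] [LieGroup 𝓘(ℝ, E) ω G]
  {K : Subgroup G} {r : ℕ}

/-- The sum of the translates of `S` by the adjoint action of the first `i` prefixes of the
word `k₁ a₁ ⋯ k_{r+1}`. -/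
noncomputable def adSpan (S : Submodule ℝ E) (a : Fin r → G) (k : Fin (r + 1) → K)
    (i : Fin (r + 1)) : Submodule ℝ E :=
  ⨆ l, ⨆ _ : l ≤ i, S.map (Ad E (wordPrefix a k l) : E →ₗ[ℝ] E)

omit [FiniteDimensional ℝ E] [LieGroup 𝓘(ℝ, E) ω G] in
theorem map_Ad_le_adSpan (S : Submodule ℝ E) (a : Fin r → G) (k : Fin (r + 1) → K)
    {l i : Fin (r + 1)} (h : l ≤ i) :
    S.map (Ad E (wordPrefix a k l) : E →ₗ[ℝ] E) ≤ adSpan S a k i :=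
  le_iSup₂_of_le l h le_rfl

omit [FiniteDimensional ℝ E] [LieGroup 𝓘(ℝ, E) ω G] in
theorem adSpan_mono (S : Submodule ℝ E) (a : Fin r → G) (k : Fin (r + 1) → K)
    {i j : Fin (r + 1)} (h : i ≤ j) : adSpan S a k i ≤ adSpan S a k j :=
  iSup₂_le fun _ hl => map_Ad_le_adSpan S a k (hl.trans h)

omit [FiniteDimensional ℝ E] [LieGroup 𝓘(ℝ, E) ω G] in
theorem adSpan_update (S : Submodule ℝ E) (a : Fin r → G) (k : Fin (r + 1) → K)
    (i : Fin (r + 1)) (x : K) : adSpan S a (Function.update k i x) i = adSpan S a k i := by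
  refine iSup_congr fun l => iSup_congr fun hl => ?_
  rw [wordPrefix_update a k hl]

-- As the range of a single operator depending continuously on `k`, the span has a lower
-- semicontinuous, hence measurable, dimension.
omit [FiniteDimensional ℝ E] [LieGroup 𝓘(ℝ, E) ω G] in
theorem adSpan_range {F : Type*} [NormedAddCommGroup F] [NormedSpace ℝ F] (T : F →L[ℝ] E)
    (a : Fin r → G) (k : Fin (r + 1) → K) (i : Fin (r + 1)) :
    adSpan (T : F →ₗ[ℝ] E).range a k i =
      ((∑ l, if l ≤ i then Ad E (wordPrefix a k l) ∘L T ∘L ContinuousLinearMap.proj l else 0 :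
        (Fin (r + 1) → F) →L[ℝ] E) : (Fin (r + 1) → F) →ₗ[ℝ] E).range := by
  apply le_antisymm
  · refine iSup₂_le fun l hl => ?_
    rintro _ ⟨_, ⟨v, rfl⟩, rfl⟩
    refine ⟨Pi.single l v, ?_⟩
    simp only [ContinuousLinearMap.coe_coe, _root_.sum_apply]
    rw [Finset.sum_eq_single l]
    · simp [hl]
    · intro j _ hj
      split_ifs <;> simp [hj]
    · simp
  · rintro _ ⟨η, rfl⟩
    simp only [ContinuousLinearMap.coe_coe, _root_.sum_apply]
    refine Submodule.sum_mem _ fun l _ => ?_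
    split_ifs with hl
    · exact map_Ad_le_adSpan _ a k hl ⟨_, ⟨η l, rfl⟩, rfl⟩
    · exact zero_mem _

theorem continuous_wordPrefix [IsTopologicalGroup G] (a : Fin r → G) (i : Fin (r + 1)) :
    Continuous fun k : Fin (r + 1) → K => wordPrefix a k i := by
  induction i using Fin.induction with
  | zero => simpa only [wordPrefix_zero] using continuous_const
  | succ j ih =>
    simp only [wordPrefix_succ]
    fun_prop

variable [IsTopologicalGroup G] [CompactSpace K] [ConnectedSpace K] [T2Space G]
  [SecondCountableTopology G] [MeasurableSpace G] [BorelSpace G]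
  (μ : Measure K) [IsFiniteMeasure μ] [μ.IsMulLeftInvariant]

omit [LieGroup 𝓘(ℝ, E) ω G] [CompactSpace K] [ConnectedSpace K] [T2Space G] in
theorem measurable_finrank_adSpan (hAd : Continuous (Ad E : G → E →L[ℝ] E)) {F : Type*}
    [NormedAddCommGroup F] [NormedSpace ℝ F]
    (T : F →L[ℝ] E) (a : Fin r → G) (i : Fin (r + 1)) :
    Measurable fun k : Fin (r + 1) → K => finrank ℝ (adSpan (T : F →ₗ[ℝ] E).range a k i) := by
  have h := measurable_finrank_range (L := fun k : Fin (r + 1) → K =>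
    (∑ l, if l ≤ i then Ad E (wordPrefix a k l) ∘L T ∘L ContinuousLinearMap.proj l else 0 :
      (Fin (r + 1) → F) →L[ℝ] E)) (continuous_finsetSum _ fun l _ => ?_)
  · convert h using 2 with k
    rw [adSpan_range]
  split_ifs
  · exact (hAd.comp (continuous_wordPrefix a l)).clm_comp continuous_const
  · exact continuous_const

/-- If `S` cannot be carried into any proper subspace containing it by `Ad (K a_i)`, then almost
every word of sufficient length moves `S` to a spanning family. -/
theorem ae_adSpan_eq_top {F : Type*} [NormedAddCommGroup F] [NormedSpace ℝ F] [FiniteDimensional ℝ F]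
    (T : F →L[ℝ] E)
    (a : Fin r → G)
    (hgen : ∀ i, ∀ W : Submodule ℝ E, (T : F →ₗ[ℝ] E).range ≤ W → W ≠ ⊤ →
      ∃ x : K, ¬ ((T : F →ₗ[ℝ] E).range.map (Ad E (a i) : E →ₗ[ℝ] E)).map
        (Ad E (x : G) : E →ₗ[ℝ] E) ≤ W)
    (hr : finrank ℝ E ≤ finrank ℝ (T : F →ₗ[ℝ] E).range + r) :
    ∀ᵐ k ∂Measure.pi fun _ : Fin (r + 1) => μ,
      adSpan (T : F →ₗ[ℝ] E).range a k (Fin.last r) = ⊤ := by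
  set S := (T : F →ₗ[ℝ] E).range with hS
  have hAd : Continuous (Ad E : G → E →L[ℝ] E) := (contMDiff_Ad E).continuous
  have hstep : ∀ j : Fin r, ∀ᵐ k ∂Measure.pi fun _ : Fin (r + 1) => μ,
      finrank ℝ (adSpan S a k j.castSucc) < finrank ℝ (adSpan S a k j.succ) ∨
        finrank ℝ E ≤ finrank ℝ (adSpan S a k j.castSucc) := by
    intro j
    have hm := fun i => measurable_finrank_adSpan (K := K) hAd T a i
    have hmeas : MeasurableSet {k : Fin (r + 1) → K |
        finrank ℝ (adSpan S a k j.castSucc) < finrank ℝ (adSpan S a k j.succ) ∨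
          finrank ℝ E ≤ finrank ℝ (adSpan S a k j.castSucc)} :=
      (measurableSet_lt (hm _) (hm _)).union (measurableSet_le measurable_const (hm _))
    -- Fubini in the letter `k j` alone: the span up to `j` does not see it, while the next prefix
    -- is `c * k j * a j`.
    refine pi_eq_zero_of_forall_update (fun _ => μ) hmeas.compl j.castSucc fun k => ?_
    by_cases htop : adSpan S a k j.castSucc = ⊤
    · refine .of_forall fun x => not_not.2 (.inr ?_)
      rw [adSpan_update, htop, finrank_top]
    set c := wordPrefix a k j.castSucc with hc
    have hcancel : ∀ v, Ad E c⁻¹ (Ad E c v) = v := fun v => by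
      rw [← ContinuousLinearMap.comp_apply, ← Ad_mul, inv_mul_cancel, Ad_one]
      rfl
    have hcancel' : ∀ v, Ad E c (Ad E c⁻¹ v) = v := fun v => by
      rw [← ContinuousLinearMap.comp_apply, ← Ad_mul, mul_inv_cancel, Ad_one]
      rfl
    -- Undoing `Ad c` turns failure of growth into `Ad x (Ad (a j) S) ≤ W`, where `W` is proper and
    -- contains `S`; this has probability zero in `x`.
    set W := (adSpan S a k j.castSucc).comap (Ad E c : E →ₗ[ℝ] E) with hW
    have hSW : S ≤ W := fun s hs => map_Ad_le_adSpan S a k le_rfl ⟨s, hs, rfl⟩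
    have hWtop : W ≠ ⊤ := by
      intro h
      refine htop (eq_top_iff.2 fun v _ => ?_)
      have h1 : Ad E c⁻¹ v ∈ W := h ▸ Submodule.mem_top
      have h2 : Ad E c (Ad E c⁻¹ v) ∈ adSpan S a k j.castSucc := h1
      rwa [hcancel'] at h2
    have hae := ae_not_map_le μ (ρ := (adHom E (G := G)).comp K.subtype)
      (hAd.comp continuous_subtype_val) (S.map (Ad E (a j) : E →ₗ[ℝ] E)) W (hgen j W hSW hWtop)
    filter_upwards [hae] with x hx hbad
    simp only [Set.mem_compl_iff, Set.mem_ofPred_eq, not_or, not_lt] at hbad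
    have heq := Submodule.eq_of_le_of_finrank_le
      (adSpan_mono S a (Function.update k j.castSucc x) j.castSucc_lt_succ.le) hbad.1
    refine hx ?_
    rintro _ ⟨_, ⟨s, hs, rfl⟩, rfl⟩
    have h1 : Ad E (wordPrefix a (Function.update k j.castSucc x) j.succ) s ∈
        adSpan S a (Function.update k j.castSucc x) j.succ :=
      map_Ad_le_adSpan S a _ le_rfl ⟨s, hs, rfl⟩
    rw [← heq, adSpan_update, wordPrefix_succ, wordPrefix_update a k le_rfl, Ad_mul, Ad_mul,
      Function.update_self] at h1
    exact h1
  filter_upwards [ae_all_iff.2 hstep] with k hk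
  -- The empty prefix already gives `S`, and each of the `r` steps adds a dimension until the space
  -- is full.
  have key : ∀ i : Fin (r + 1), min (finrank ℝ E) (finrank ℝ S + i) ≤
      finrank ℝ (adSpan S a k i) := by
    intro i
    induction i using Fin.induction with
    | zero =>
      refine (min_le_right _ _).trans (Submodule.finrank_mono ?_)
      have h1 := map_Ad_le_adSpan S a k (le_refl 0)
      rw [wordPrefix_zero, Ad_one] at h1
      exact (Submodule.map_id S).symm.trans_le h1
    | succ j ih =>
      have h1 : finrank ℝ (adSpan S a k j.castSucc) ≤ finrank ℝ (adSpan S a k j.succ) :=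
        Submodule.finrank_mono (adSpan_mono S a k j.castSucc_lt_succ.le)
      have h2 := hk j
      simp only [Fin.val_castSucc, Fin.val_succ] at ih ⊢
      omega
  have hlast := key (Fin.last r)
  rw [Fin.val_last, min_eq_left hr] at hlast
  exact Submodule.eq_top_of_finrank_eq (le_antisymm (Submodule.finrank_le _) hlast)

end Rank

end OrbitalMeasure

namespace OrbitalMeasure

/-! ### From full rank to null preimages -/

section Submersion

open Filter Topology Module

variable {E : Type*} [NormedAddCommGroup E] [NormedSpace ℝ E]
  {G : Type*} [TopologicalSpace G] [ChartedSpace E G] [Group G] [LieGroup 𝓘(ℝ, E) ω G]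
  {F : Type*} [NormedAddCommGroup F] [NormedSpace ℝ F]
  {K : Subgroup G} [ChartedSpace F K] [LieGroup 𝓘(ℝ, F) ω K] {r : ℕ}

omit [LieGroup 𝓘(ℝ, F) ω K] in
theorem contMDiffAt_word (hK : ContMDiff 𝓘(ℝ, F) 𝓘(ℝ, E) ω (Subtype.val : K → G))
    {V : Type*} [NormedAddCommGroup V] [NormedSpace ℝ V] {v : V} (a : Fin r → G)
    {κ : V → Fin (r + 1) → K}
    (hκ : ∀ i, ContMDiffAt 𝓘(ℝ, V) 𝓘(ℝ, F) ω (fun y => κ y i) v) :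
    ContMDiffAt 𝓘(ℝ, V) 𝓘(ℝ, E) ω (fun y => word a (κ y)) v := by
  have hκ' : ∀ i, ContMDiffAt 𝓘(ℝ, V) 𝓘(ℝ, E) ω (fun y => (κ y i : G)) v :=
    fun i => hK.contMDiffAt.comp v (hκ i)
  induction r with
  | zero => simpa only [word_zero] using hκ' 0
  | succ r ih =>
    simp only [word_succ]
    exact ((hκ' 0).mul contMDiffAt_const).mul
      (ih (Fin.tail a) (κ := fun y => Fin.tail (κ y)) (fun i => hκ i.succ) fun i => hκ' i.succ)

variable (E F) in
/-- The map `x ↦ word a (k x) (word a k)⁻¹` in charts at the identity. -/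
noncomputable def wordChart (a : Fin r → G) (k : Fin (r + 1) → K) (y : Fin (r + 1) → F) : E :=
  extChartAt 𝓘(ℝ, E) (1 : G)
    (word a (k * fun i => (extChartAt 𝓘(ℝ, F) (1 : K)).symm (y i)) * (word a k)⁻¹)

theorem contDiffAt_wordChart (hK : ContMDiff 𝓘(ℝ, F) 𝓘(ℝ, E) ω (Subtype.val : K → G))
    (a : Fin r → G) (k : Fin (r + 1) → K) :
    ContDiffAt ℝ ω (wordChart E F a k) fun _ => extChartAt 𝓘(ℝ, F) (1 : K) 1 := by
  rw [← contMDiffAt_iff_contDiffAt]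
  have h1 := contMDiffAt_word hK (v := fun _ : Fin (r + 1) => extChartAt 𝓘(ℝ, F) (1 : K) 1) a
    (κ := fun y => k * fun i => (extChartAt 𝓘(ℝ, F) (1 : K)).symm (y i)) fun i =>
      ContMDiffAt.mul contMDiffAt_const (ContMDiffAt.comp (I' := 𝓘(ℝ, F)) _
        (contMDiffAt_extChartAt_symm_one F K)
        (ContinuousLinearMap.proj (R := ℝ) (φ := fun _ : Fin (r + 1) => F)
          i).contDiff.contMDiff.contMDiffAt)
  have h2 := h1.mul (contMDiffAt_const (c := (word a k)⁻¹))
  refine ContMDiffAt.comp_of_eq (I' := 𝓘(ℝ, E)) (y := (1 : G)) contMDiffAt_extChartAt h2 ?_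
  have : (k * fun _ => 1) = k := mul_one k
  simp only [extChartAt_to_inv]
  rw [this, mul_inv_cancel]

omit [LieGroup 𝓘(ℝ, E) ω G] [LieGroup 𝓘(ℝ, F) ω K] in
theorem wordChart_update (a : Fin r → G) (k : Fin (r + 1) → K) (i : Fin (r + 1)) (η : F) :
    wordChart E F a k (Function.update (fun _ => extChartAt 𝓘(ℝ, F) (1 : K) 1) i η) =
      extChartAt 𝓘(ℝ, E) (1 : G) ((wordPrefix a k i * k i) *
        ((extChartAt 𝓘(ℝ, F) (1 : K)).symm η : K) * (wordPrefix a k i * k i)⁻¹) := by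
  have : (fun l => (extChartAt 𝓘(ℝ, F) (1 : K)).symm
      (Function.update (fun _ => extChartAt 𝓘(ℝ, F) (1 : K) 1) i η l)) =
      Pi.mulSingle i ((extChartAt 𝓘(ℝ, F) (1 : K)).symm η) := by
    funext l
    by_cases h : l = i
    · subst h
      rw [Function.update_self, Pi.mulSingle_eq_same]
    · rw [Function.update_of_ne h, Pi.mulSingle_eq_of_ne h, extChartAt_to_inv]
  rw [wordChart, this, word_mul_mulSingle, mul_inv_cancel_right]

/-- The partial derivative in the `i`-th letter is `Ad (wordPrefix a k i * k i) ∘ T`; the last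
factor `k i` may be dropped because `Ad (k i)` maps the range of `T` onto itself. -/
theorem adSpan_le_range_wordChart {T : F →L[ℝ] E}
    (hT : HasMFDerivAt 𝓘(ℝ, F) 𝓘(ℝ, E) (Subtype.val : K → G) (1 : K) T)
    (a : Fin r → G) (k : Fin (r + 1) → K) {f' : (Fin (r + 1) → F) →L[ℝ] E}
    (hf : HasFDerivAt (wordChart E F a k) f' fun _ => extChartAt 𝓘(ℝ, F) (1 : K) 1) :
    adSpan (T : F →ₗ[ℝ] E).range a k (Fin.last r) ≤ (f' : (Fin (r + 1) → F) →ₗ[ℝ] E).range := by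
  refine iSup₂_le fun i _ => ?_
  set y₀ := extChartAt 𝓘(ℝ, F) (1 : K) 1 with hy₀
  set c := wordPrefix a k i * k i with hc
  have h1 : HasFDerivAt (fun η : F => wordChart E F a k (Function.update (fun _ => y₀) i η))
      (Ad E c ∘L T) y₀ := by
    have h0 := funext (wordChart_update (E := E) (F := F) a k i)
    rw [← hy₀] at h0
    rw [h0]
    have h2 := (hasMFDerivAt_extChartAt_one E).comp_of_point_eq
      ((hasMFDerivAt_conj E c).comp_of_point_eq
        (hT.comp_of_point_eq (hasMFDerivAt_extChartAt_symm_one F) (extChartAt_to_inv _))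
        (by simp)) (by simp)
    exact hasMFDerivAt_iff_hasFDerivAt.1 h2
  have h3 : HasFDerivAt (fun η : F => wordChart E F a k (Function.update (fun _ => y₀) i η))
      (f' ∘L .pi (Pi.single i (.id ℝ F))) y₀ := by
    have hf₀ : HasFDerivAt (wordChart E F a k) f' (Function.update (fun _ => y₀) i y₀) := by
      have h0 : Function.update (fun _ : Fin (r + 1) => y₀) i y₀ = fun _ => y₀ :=
        Function.update_eq_self i fun _ => y₀
      rwa [h0]
    exact hf₀.comp y₀ (hasFDerivAt_update (fun _ => y₀) y₀)
  have h4 := h1.unique h3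
  rintro _ ⟨_, ⟨X, rfl⟩, rfl⟩
  have h5 := congrArg (fun L : F →L[ℝ] E => L X)
    (Ad_comp_deriv (j := K.subtype) hT (k i)⁻¹)
  have h6 : Ad E (wordPrefix a k i) (T X) = Ad E c (T (Ad F (k i)⁻¹ X)) := by
    have h7 : T (Ad F (k i)⁻¹ X) = Ad E ((k i : G))⁻¹ (T X) := h5.symm
    have h8 := congrArg (fun L : E →L[ℝ] E => L (T X)) (Ad_mul E c (k i : G)⁻¹)
    rw [hc, mul_inv_cancel_right] at h8
    rw [h7]
    exact h8
  refine ⟨ContinuousLinearMap.pi (Pi.single i (.id ℝ F)) (Ad F (k i)⁻¹ X), ?_⟩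
  exact (congrArg (fun L : F →L[ℝ] E => L (Ad F (k i)⁻¹ X)) h4).symm.trans h6.symm

variable [FiniteDimensional ℝ E] [FiniteDimensional ℝ F] [SecondCountableTopology G]
  [MeasurableSpace G] [BorelSpace G]

/-- Nullity is carried from `G` to its chart, through the submersion `wordChart` to the chart of
`K^(r+1)`, and from there to the product Haar measure near `k`. -/
theorem exists_mem_nhds_measure_inter_word_preimage_eq_zero
    (hK : ContMDiff 𝓘(ℝ, F) 𝓘(ℝ, E) ω (Subtype.val : K → G)) {T : F →L[ℝ] E}
    (hT : HasMFDerivAt 𝓘(ℝ, F) 𝓘(ℝ, E) (Subtype.val : K → G) (1 : K) T)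
    (μ : Measure G) [IsFiniteMeasure μ] [μ.IsHaarMeasure]
    (μK : Measure K) [IsFiniteMeasure μK] [μK.IsHaarMeasure]
    (a : Fin r → G) (k : Fin (r + 1) → K)
    (hk : adSpan (T : F →ₗ[ℝ] E).range a k (Fin.last r) = ⊤) {N : Set G}
    (hN : MeasurableSet N) (hN0 : μ N = 0) :
    ∃ W ∈ 𝓝 k, (Measure.pi fun _ => μK) (W ∩ word a ⁻¹' N) = 0 := by
  have : IsTopologicalGroup G := topologicalGroup_of_lieGroup 𝓘(ℝ, E) ω
  have : ProperSpace F := FiniteDimensional.proper_real F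
  borelize E F
  have hd := (contDiffAt_wordChart hK a k).hasStrictFDerivAt (by simp)
  have hsurj : Function.Surjective (fderiv ℝ (wordChart E F a k)
      fun _ => extChartAt 𝓘(ℝ, F) (1 : K) 1) :=
    LinearMap.range_eq_top.1 (eq_top_iff.2 (hk.symm.trans_le
      (adSpan_le_range_wordChart hT a k hd.hasFDerivAt)))
  have hchart := isDifferentiableChart_extChartAt (E := E) (G := G)
  have hchartK := (isDifferentiableChart_extChartAt (E := F) (G := K)).pi (ι := Fin (r + 1))
  obtain ⟨B, hB, hB0⟩ := hchart.exists_mem_nhds_measure_chart_eq_zero μ Measure.addHaar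
    (A := (fun u => u * word a k) ⁻¹' N) (measurable_mul_const _ hN)
    ((measure_mul_right_null μ _).2 hN0)
  obtain ⟨V, hV, hV0⟩ := exists_mem_nhds_forall_measure_inter_preimage_eq_zero
    (Measure.addHaar : Measure (Fin (r + 1) → F)) Measure.addHaar hd hsurj
  have hword : Continuous (word a : (Fin (r + 1) → K) → G) := continuous_word a
  have hw0 : wordChart E F a k (fun _ => extChartAt 𝓘(ℝ, F) (1 : K) 1) =
      extChartAt 𝓘(ℝ, E) (1 : G) 1 := by
    have : (k * fun _ => 1) = k := mul_one k
    simp only [wordChart, extChartAt_to_inv]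
    rw [this, mul_inv_cancel]
  have hcont : ContinuousAt (wordChart E F a k) fun _ => extChartAt 𝓘(ℝ, F) (1 : K) 1 :=
    hd.continuousAt
  have hinv : ∀ᶠ y in 𝓝 (fun _ : Fin (r + 1) => extChartAt 𝓘(ℝ, F) (1 : K) 1),
      (extChartAt 𝓘(ℝ, E) (1 : G)).symm (wordChart E F a k y) =
        word a (k * fun i => (extChartAt 𝓘(ℝ, F) (1 : K)).symm (y i)) * (word a k)⁻¹ := by
    have h1 : ContinuousAt (fun y : Fin (r + 1) → F =>
        word a (k * fun i => (extChartAt 𝓘(ℝ, F) (1 : K)).symm (y i)) * (word a k)⁻¹)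
        fun _ => extChartAt 𝓘(ℝ, F) (1 : K) 1 :=
      (hword.continuousAt.comp
        (continuousAt_const.mul hchartK.continuousAt_symm.self_of_nhds)).mul continuousAt_const
    refine h1.eventually (p := fun g => (extChartAt 𝓘(ℝ, E) (1 : G)).symm
      (extChartAt 𝓘(ℝ, E) (1 : G) g) = g) ?_
    have : (k * fun _ => 1) = k := mul_one k
    simp only [extChartAt_to_inv]
    rw [this, mul_inv_cancel]
    exact hchart.left_inv
  have hA : MeasurableSet {x : Fin (r + 1) → K | word a (k * x) ∈ N} :=
    (hword.comp (continuous_const.mul continuous_id)).measurable hN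
  have hB' := hcont.eventually (hw0 ▸ hB)
  obtain ⟨W, hW, hW0⟩ := hchartK.exists_mem_nhds_measure_inter_eq_zero
    (Measure.pi fun _ => μK) Measure.addHaar hA
    (B₀ := V ∩ {y | wordChart E F a k y ∈ B ∧ (extChartAt 𝓘(ℝ, E) (1 : G)).symm
      (wordChart E F a k y) =
        word a (k * fun i => (extChartAt 𝓘(ℝ, F) (1 : K)).symm (y i)) * (word a k)⁻¹})
    (inter_mem hV (hB'.and hinv)) (by
      refine measure_mono_null ?_ (hV0 _ hB0)
      rintro y ⟨⟨hyV, hyB, hy⟩, hyN⟩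
      refine ⟨hyV, hyB, ?_⟩
      simp only [Set.mem_preimage]
      rw [hy, inv_mul_cancel_right]
      exact hyN)
  refine ⟨(fun x => k⁻¹ * x) ⁻¹' W, ?_, ?_⟩
  · refine (continuous_const_mul k⁻¹).continuousAt.preimage_mem_nhds ?_
    rwa [inv_mul_cancel]
  · rw [← measure_preimage_mul _ k⁻¹] at hW0
    refine measure_mono_null (fun x hx => ?_) hW0
    exact ⟨hx.1, by simpa using hx.2⟩

theorem measure_word_preimage_eq_zero
    (hK : ContMDiff 𝓘(ℝ, F) 𝓘(ℝ, E) ω (Subtype.val : K → G)) {T : F →L[ℝ] E}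
    (hT : HasMFDerivAt 𝓘(ℝ, F) 𝓘(ℝ, E) (Subtype.val : K → G) (1 : K) T)
    (μ : Measure G) [IsFiniteMeasure μ] [μ.IsHaarMeasure]
    (μK : Measure K) [IsFiniteMeasure μK] [μK.IsHaarMeasure] (a : Fin r → G)
    (h : ∀ᵐ k ∂Measure.pi fun _ : Fin (r + 1) => μK,
      adSpan (T : F →ₗ[ℝ] E).range a k (Fin.last r) = ⊤) {N : Set G}
    (hN : MeasurableSet N) (hN0 : μ N = 0) :
    (Measure.pi fun _ => μK) (word a ⁻¹' N) = 0 := by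
  set S := {k : Fin (r + 1) → K | adSpan (T : F →ₗ[ℝ] E).range a k (Fin.last r) = ⊤} with hS
  -- Locally null sets are null by second countability; outside `S` the hypothesis `h` takes over.
  have h1 : (Measure.pi fun _ => μK) (word a ⁻¹' N ∩ S) = 0 := by
    refine measure_null_of_locally_null _ fun k hk => ?_
    obtain ⟨W, hW, hW0⟩ :=
      exists_mem_nhds_measure_inter_word_preimage_eq_zero hK hT μ μK a k hk.2 hN hN0
    exact ⟨_, inter_mem (mem_nhdsWithin_of_mem_nhds hW)
      (mem_of_superset self_mem_nhdsWithin Set.inter_subset_left), hW0⟩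
  exact measure_mono_null (fun k hk => (em (k ∈ S)).imp (fun hs => ⟨hk, hs⟩) id)
    (measure_union_null h1 h)

end Submersion

end OrbitalMeasure

namespace OrbitalMeasure

/-! ### Application to the compact pair -/

section Main

variable {𝔤 : Type*} [LieRing 𝔤] [LieAlgebra ℝ 𝔤] [FiniteDimensional ℝ 𝔤]
  {C : CartanDecomposition 𝔤} {m d : ℕ} {U : Type*} [Group U] [TopologicalSpace U]
  [ChartedSpace (EuclideanSpace ℝ (Fin m)) U] [LieGroup (𝓡 m) ω U] {K : Subgroup U}
  [ChartedSpace (EuclideanSpace ℝ (Fin d)) K]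

variable (m d K) in
/-- `inclusionDeriv` as a map of Euclidean spaces. -/
noncomputable def inclusionDerivEuclidean :
    EuclideanSpace ℝ (Fin d) →L[ℝ] EuclideanSpace ℝ (Fin m) :=
  inclusionDeriv (m := m) (d := d) K

namespace IsCompactPair

omit [FiniteDimensional ℝ 𝔤] in
theorem hasMFDerivAt (h : IsCompactPair (m := m) (d := d) C K) :
    HasMFDerivAt (𝓡 d) (𝓡 m) (Subtype.val : K → U) (1 : K) (inclusionDerivEuclidean m d K) :=
  (h.contMDiff_val.mdifferentiableAt (by simp)).hasMFDerivAt

omit [FiniteDimensional ℝ 𝔤] in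
theorem injective_inclusionDerivEuclidean (h : IsCompactPair (m := m) (d := d) C K) :
    Function.Injective (inclusionDerivEuclidean m d K) :=
  h.injective_deriv

variable [LieGroup (𝓡 d) ω K]

-- Stability under `Ad K` differentiates to stability under brackets with the Lie algebra of `K`;
-- the isomorphism with the compact form then reduces to the algebraic dichotomy
-- `subset_kC_or_eq_top`.
omit [LieGroup (𝓡 d) ω K] in
theorem subset_range_or_eq_top (h : IsCompactPair (m := m) (d := d) C K)
    (hirr : C.IsIrreducible) (S : Submodule ℝ (EuclideanSpace ℝ (Fin m)))
    (hS : (inclusionDerivEuclidean m d K :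
      EuclideanSpace ℝ (Fin d) →ₗ[ℝ] EuclideanSpace ℝ (Fin m)).range ≤ S)
    (hinv : ∀ x : K, ∀ s ∈ S, Ad (EuclideanSpace ℝ (Fin m)) (x : U) s ∈ S) :
    S ≤ (inclusionDerivEuclidean m d K :
      EuclideanSpace ℝ (Fin d) →ₗ[ℝ] EuclideanSpace ℝ (Fin m)).range ∨ S = ⊤ := by
  obtain ⟨φ, hφ⟩ := h.exists_lieEquiv
  let S₀ : Submodule ℝ (GroupLieAlgebra (𝓡 m) U) := S
  have hmem : ∀ y : C.compactForm, y ∈ S₀.map (φ : GroupLieAlgebra (𝓡 m) U →ₗ[ℝ] C.compactForm) ↔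
      φ.symm y ∈ S₀ := by
    intro y
    constructor
    · rintro ⟨s, hs, rfl⟩
      have : φ.symm (φ s) = s := φ.symm_apply_apply s
      exact this.symm ▸ hs
    · intro hy
      exact ⟨φ.symm y, hy, φ.apply_symm_apply y⟩
  have hk : ∀ y : C.compactForm, (y : ℂ ⊗[ℝ] 𝔤) ∈ C.kC →
      φ.symm y ∈ Set.range (inclusionDeriv (m := m) (d := d) K) := fun y hy => by
    rw [hφ, φ.apply_symm_apply]
    exact hy
  refine (C.subset_kC_or_eq_top hirr
    (S₀.map (φ : GroupLieAlgebra (𝓡 m) U →ₗ[ℝ] C.compactForm)) (fun y hy => ?_)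
    (fun x hx y hy => ?_)).imp (fun h1 => ?_) (fun h1 => ?_)
  · rw [hmem]
    obtain ⟨X, hX⟩ := hk y hy
    exact hS ⟨X, hX⟩
  · rw [hmem] at hy ⊢
    obtain ⟨X, hX⟩ := hk x hx
    have h2 : φ.symm ⁅x, y⁆ = ⁅φ.symm x, φ.symm y⁆ := LieEquiv.map_lie φ.symm x y
    rw [h2, ← hX]
    exact lie_mem_of_forall_Ad_mem (f := (Subtype.val : K → U)) (x₀ := 1) rfl h.hasMFDerivAt
      hinv X hy
  · intro s hs
    have h2 := h1 (φ s) ⟨s, hs, rfl⟩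
    obtain ⟨X, hX⟩ := (hφ s).2 h2
    exact ⟨X, hX⟩
  · refine eq_top_iff.2 fun v _ => ?_
    have h2 : φ v ∈ S₀.map (φ : GroupLieAlgebra (𝓡 m) U →ₗ[ℝ] C.compactForm) :=
      h1 ▸ Submodule.mem_top
    rw [hmem] at h2
    have : φ.symm (φ v) = v := φ.symm_apply_apply v
    exact this ▸ h2

theorem exists_not_map_Ad_le (h : IsCompactPair (m := m) (d := d) C K)
    (hirr : C.IsIrreducible) {a : U} (ha : a ∉ Subgroup.normalizer (K : Set U))
    (W : Submodule ℝ (EuclideanSpace ℝ (Fin m)))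
    (hW : (inclusionDerivEuclidean m d K :
      EuclideanSpace ℝ (Fin d) →ₗ[ℝ] EuclideanSpace ℝ (Fin m)).range ≤ W) (hWtop : W ≠ ⊤) :
    ∃ x : K, ¬ ((inclusionDerivEuclidean m d K :
      EuclideanSpace ℝ (Fin d) →ₗ[ℝ] EuclideanSpace ℝ (Fin m)).range.map
        (Ad (EuclideanSpace ℝ (Fin m)) a :
          EuclideanSpace ℝ (Fin m) →ₗ[ℝ] EuclideanSpace ℝ (Fin m))).map
        (Ad (EuclideanSpace ℝ (Fin m)) (x : U) :
          EuclideanSpace ℝ (Fin m) →ₗ[ℝ] EuclideanSpace ℝ (Fin m)) ≤ W := by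
  by_contra! hcon
  have : ConnectedSpace K := Subtype.connectedSpace h.isConnected
  set R := (inclusionDerivEuclidean m d K :
      EuclideanSpace ℝ (Fin d) →ₗ[ℝ] EuclideanSpace ℝ (Fin m)).range with hR
  set P := R.map (Ad (EuclideanSpace ℝ (Fin m)) a :
    EuclideanSpace ℝ (Fin m) →ₗ[ℝ] EuclideanSpace ℝ (Fin m)) with hP
  -- The smallest `K`-stable subspace containing `R` and `Ad a R`. If it equals `R`, then `a`
  -- normalizes `K`; if it is everything, then so is `W`.
  set S := R ⊔ ⨆ x : K, P.map (Ad (EuclideanSpace ℝ (Fin m)) (x : U) :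
    EuclideanSpace ℝ (Fin m) →ₗ[ℝ] EuclideanSpace ℝ (Fin m)) with hS
  have hSinv : ∀ x : K, ∀ s ∈ S, Ad (EuclideanSpace ℝ (Fin m)) (x : U) s ∈ S := by
    intro x
    change S ≤ S.comap (Ad (EuclideanSpace ℝ (Fin m)) (x : U) :
      EuclideanSpace ℝ (Fin m) →ₗ[ℝ] EuclideanSpace ℝ (Fin m))
    refine sup_le ?_ (iSup_le fun y => ?_)
    · rw [← Submodule.map_le_iff_le_comap]
      exact (map_Ad_range (j := K.subtype) h.hasMFDerivAt x).trans le_sup_left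
    · rintro _ ⟨p, hp, rfl⟩
      have h1 : Ad (EuclideanSpace ℝ (Fin m)) ((x * y : K) : U) p ∈ S :=
        (le_iSup (fun x : K => P.map (Ad (EuclideanSpace ℝ (Fin m)) (x : U) :
          EuclideanSpace ℝ (Fin m) →ₗ[ℝ] EuclideanSpace ℝ (Fin m))) (x * y)).trans le_sup_right
          ⟨p, hp, rfl⟩
      rw [Subgroup.coe_mul, Ad_mul] at h1
      exact h1
  rcases h.subset_range_or_eq_top hirr S le_sup_left hSinv with h1 | h1
  · refine ha (mem_normalizer_of_map_Ad_le h.contMDiff_val h.hasMFDerivAt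
      h.injective_inclusionDerivEuclidean ?_)
    refine le_trans ?_ h1
    refine le_trans ?_ ((le_iSup _ (1 : K)).trans le_sup_right)
    rw [Subgroup.coe_one, Ad_one]
    exact (Submodule.map_id P).ge
  · exact hWtop (top_le_iff.1 (h1 ▸ sup_le hW (iSup_le hcon)))

end IsCompactPair

end Main

end OrbitalMeasure

theorem mainTheorem3
    {𝔤 : Type*} [LieRing 𝔤] [LieAlgebra ℝ 𝔤] [FiniteDimensional ℝ 𝔤]
    [LieAlgebra.IsSemisimple ℝ 𝔤]
    (C : OrbitalMeasure.CartanDecomposition 𝔤)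
    (hirr : C.IsIrreducible) (hherm : C.IsHermitian)
    {m d : ℕ} {U : Type*} [Group U] [TopologicalSpace U] [T2Space U]
    [CompactSpace U] [ConnectedSpace U]
    [ChartedSpace (EuclideanSpace ℝ (Fin m)) U] [LieGroup (𝓡 m) ω U]
    (K : Subgroup U)
    [ChartedSpace (EuclideanSpace ℝ (Fin d)) K] [LieGroup (𝓡 d) ω K]
    (hUK : OrbitalMeasure.IsCompactPair (m := m) (d := d) C K)
    [MeasurableSpace U] [BorelSpace U]
    (μU : Measure U) [μU.IsHaarMeasure] [IsProbabilityMeasure μU]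
    (μK : Measure K) [μK.IsHaarMeasure] [IsProbabilityMeasure μK]
    (χ : K →* ℂ) (hχ : Continuous χ)
    {r : ℕ} (a : Fin r → U)
    (ha : ∀ i, a i ∉ Subgroup.normalizer (K : Set U)) :
    (∃! μ : ComplexMeasure U, OrbitalMeasure.IsOrbitalMeasure μK χ a μ) ∧
      ((m : ℤ) - (d : ℤ) ≤ (r : ℤ) →
        ∀ μ : ComplexMeasure U, OrbitalMeasure.IsOrbitalMeasure μK χ a μ →
          μ ≪ᵥ μU.toENNRealVectorMeasure) := by
  open OrbitalMeasure in
  have : IsTopologicalGroup U := topologicalGroup_of_lieGroup (𝓡 m) ω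
  have : SecondCountableTopology U :=
    ChartedSpace.secondCountable_of_sigmaCompact (EuclideanSpace ℝ (Fin m)) U
  have : TopologicalSpace.MetrizableSpace U :=
    TopologicalSpace.metrizableSpace_of_t3_secondCountable U
  have : CompactSpace K := isCompact_iff_compactSpace.1 hUK.isClosed.isCompact
  have : ConnectedSpace K := Subtype.connectedSpace hUK.isConnected
  have hex := isOrbitalMeasure_orbitalMeasure μK hχ hUK.isClosed a
  have huniq : ∀ μ : ComplexMeasure U, IsOrbitalMeasure μK χ a μ →
      μ = orbitalMeasure μK χ a := fun μ hμ =>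
    complexMeasure_ext_of_integral_continuous fun f => (hμ f).trans (hex f).symm
  refine ⟨⟨_, hex, huniq⟩, fun hr μ hμ => ?_⟩
  rw [huniq μ hμ]
  refine orbitalMeasure_absolutelyContinuous μK hχ hUK.isClosed μU a fun N hN hN0 => ?_
  refine measure_word_preimage_eq_zero hUK.contMDiff_val hUK.hasMFDerivAt μU μK a
    (ae_adSpan_eq_top μK _ a (fun i W => hUK.exists_not_map_Ad_le hirr (ha i) W) ?_) hN hN0
  -- The starting subspace has dimension `d`, so reaching dimension `m` takes at most `m - d`
  -- letters; this is where the bound on `r` enters.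
  rw [LinearMap.finrank_range_of_inj hUK.injective_inclusionDerivEuclidean]
  simp only [finrank_euclideanSpace, Fintype.card_fin]
  omega
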